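/- **Setting.** Let $-\infty<a<b<\infty$ and let $p,q,r$ be real-valued functions on $(a,b)$ with $p>0$, $r>0$ a.e. and $1/p,\,q,\,r\in L^1((a,b);dx)$. Put $y^{[1]}=py'$ and $\tau y=\frac1r\big[-(y^{[1]})'+qy\big]$. In $L^2((a,b);r\,dx)$ let $H_{\max}f=\tau f$ on $$\operatorname{dom}(H_{\max})=\{g\in L^2((a,b);r\,dx)\mid g,g^{[1]}\in AC([a,b]),\ \tau g\in L^2((a,b);r\,dx)\},$$ and let $H_{\min}$ be its restriction to those $g$ with $g(a)=g^{[1]}(a)=g(b)=g^{[1]}(b)=0$. Scalar products are linear in the second argument. For $A,B\in\mathbb C^{2\times2}$ with $$\operatorname{rank}(A\ \ B)=2,\qquad AJA^*=BJB^*,\qquad J=\begin{pmatrix}0&-1\\1&0\end{pmatrix},\tag{1}$$ put $$\gamma_{A,B}u=A\binom{u(a)}{u^{[1]}(a)}-B\binom{u(b)}{u^{[1]}(b)},\quad \gamma_Du=\binom{u(a)}{u(b)},\quad \gamma_Nu=\binom{u^{[1]}(a)}{-u^{[1]}(b)},$$ and let $H_{A,B}$ be the restriction of $H_{\max}$ to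 $\{g\in\operatorname{dom}(H_{\max})\mid\gamma_{A,B}g=0\}$, a self-adjoint extension of $H_{\min}$. Let $$D_{A,B}=\begin{pmatrix}A_{1,1}&-B_{1,1}\\A_{2,1}&-B_{2,1}\end{pmatrix},\qquad N_{A,B}=\begin{pmatrix}A_{1,2}&B_{1,2}\\A_{2,2}&B_{2,2}\end{pmatrix},$$ $$\gamma^\perp_{A,B}=-[D_{A,B}D_{A,B}^*+N_{A,B}N_{A,B}^*]^{-1}N_{A,B}\,\gamma_D+[D_{A,B}D_{A,B}^*+N_{A,B}N_{A,B}^*]^{-1}D_{A,B}\,\gamma_N,$$ and, for two pairs $(A,B)$, $(A',B')$ satisfying (1), $S=S_{A',B',A,B}=N_{A',B'}D_{A,B}^*-D_{A',B'}N_{A,B}^*$. For $z\in\rho(H_{A,B})$ the boundary data map $\Lambda(z)=\Lambda_{A,B}^{A',B'}(z)\in\mathbb C^{2\times2}$ is defined by $\Lambda(z)c=\gamma_{A',B'}u$, where $u$ is the unique solution of $-(u^{[1]})'+qu=zru$, $u,u^{[1]}\in AC([a,b])$, with $\gamma_{A,B}u=c\in\mathbb C^2$. **Theorem (Krein's resolvent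 formula via boundary data maps).** Let $(A,B)$ and $(A',B')$ satisfy (1), and let $z\in\rho(H_{A,B})\cap\rho(H_{A',B'})$. Then $H_{A,B}$ and $H_{A',B'}$ are self-adjoint extensions of $H_{\min}$ (so that $\bar z\in\rho(H_{A,B})$), the operators $\gamma^\perp_{A,B}(H_{A,B}-w)^{-1}$ and $\gamma_{A',B'}(H_{A,B}-w)^{-1}$, $w\in\{z,\bar z\}$, are bounded from $L^2((a,b);r\,dx)$ to $\mathbb C^2$, the matrix $\Lambda(z)$ is well defined and invertible, and $$(H_{A',B'}-z)^{-1}=(H_{A,B}-z)^{-1}-\big[\gamma^\perp_{A,B}(H_{A,B}-\bar z)^{-1}\big]^*\Lambda(z)^{-1}S\,\big[\gamma^\perp_{A,B}(H_{A,B}-z)^{-1}\big].$$ If $S$ is invertible, then $\Lambda(z)S^*$ is invertible and $$(H_{A',B'}-z)^{-1}=(H_{A,B}-z)^{-1}-\big[\gamma_{A',B'}(H_{A,B}-\bar z)^{-1}\big]^*\big[\Lambda(z)S^*\big]^{-1}\big[\gamma_{A',B'}(H_{A,B}-z)^{-1}\big].$$ If $S$ is not invertible and nonzero (i.e. $\operatorname{rank}S=1$),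 then, with $P$ the orthogonal projection of $\mathbb C^2$ onto $\operatorname{ran}S$ and $$\lambda(z)=P\,\Lambda(z)S^*P\big|_{\operatorname{ran}S}:\operatorname{ran}S\to\operatorname{ran}S,$$ the operator $\gamma_{A',B'}(H_{A,B}-z)^{-1}$ has range in $\operatorname{ran}S$, $\lambda(z)$ is invertible, and $$(H_{A',B'}-z)^{-1}=(H_{A,B}-z)^{-1}-\big[\gamma_{A',B'}(H_{A,B}-\bar z)^{-1}\big]^*\lambda(z)^{-1}\big[\gamma_{A',B'}(H_{A,B}-z)^{-1}\big].$$ -/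

import Mathlib

open MeasureTheory Set
open scoped Matrix InnerProductSpace

noncomputable section

/-- Coefficients of a regular Sturm-Liouville expression
`τ = (1/r) [-(d/dx) p (d/dx) + q]` on a bounded interval `(a, b)`. -/
structure SturmLiouville where
  a : ℝ
  b : ℝ
  hab : a < b
  p : ℝ → ℝ
  q : ℝ → ℝ
  r : ℝ → ℝ
  r_pos : ∀ᵐ x ∂(volume.restrict (Ioo a b)), 0 < r x
  r_int : IntegrableOn r (Ioo a b)
  p_pos : ∀ᵐ x ∂(volume.restrict (Ioo a b)), 0 < p x
  p_inv_int : IntegrableOn (fun x => 1 / p x) (Ioo a b)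
  q_int : IntegrableOn q (Ioo a b)

namespace SturmLiouville

variable (L : SturmLiouville)

/-- The measure `r dx` on `(a, b)`. -/
def μ : Measure ℝ :=
  (volume.restrict (Ioo L.a L.b)).withDensity (fun x => ENNReal.ofReal (L.r x))

/-- The Hilbert space `L²((a,b); r dx)`. -/
abbrev Space := Lp ℂ 2 L.μ

/-- The pairs `(y, y^[1])` with `y, y^[1] ∈ AC([a,b])` and `y^[1] = p y'` a.e. on `(a, b)`.
The second component is the absolutely continuous representative of the quasi-derivative, so that
its values at the endpoints make sense. -/
def pairs : Submodule ℂ ((ℝ → ℂ) × (ℝ → ℂ)) where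
  carrier := {u | AbsolutelyContinuousOnInterval u.1 L.a L.b ∧
    AbsolutelyContinuousOnInterval u.2 L.a L.b ∧
    ∀ᵐ x ∂(volume.restrict (Ioo L.a L.b)), u.2 x = (L.p x : ℂ) * deriv u.1 x}
  zero_mem' := by
    have h0 : AbsolutelyContinuousOnInterval (0 : ℝ → ℂ) L.a L.b := by
      have := (LipschitzWith.const (α := ℝ) (0 : ℂ)).lipschitzOnWith
        (s := uIcc L.a L.b)
      exact this.absolutelyContinuousOnInterval
    refine ⟨h0, h0, Filter.Eventually.of_forall fun x => ?_⟩
    have : deriv (0 : ℝ → ℂ) x = 0 := by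
      exact deriv_const x (0 : ℂ)
    simp [this]
  add_mem' := by
    rintro u v ⟨hu1, hu2, hu3⟩ ⟨hv1, hv2, hv3⟩
    refine ⟨hu1.add hv1, hu2.add hv2, ?_⟩
    have du := hu1.boundedVariationOn.ae_differentiableAt_of_mem_uIcc
    have dv := hv1.boundedVariationOn.ae_differentiableAt_of_mem_uIcc
    filter_upwards [hu3, hv3, ae_restrict_of_ae du, ae_restrict_of_ae dv,
      ae_restrict_mem measurableSet_Ioo] with x h1 h2 h3 h4 hx
    have hx' : x ∈ uIcc L.a L.b := Ioo_subset_Icc_self.trans Icc_subset_uIcc hx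
    have : deriv (u + v).1 x = deriv u.1 x + deriv v.1 x := deriv_add (h3 hx') (h4 hx')
    rw [this]
    simp [h1, h2, mul_add]
  smul_mem' := by
    rintro c u ⟨hu1, hu2, hu3⟩
    refine ⟨hu1.const_smul c, hu2.const_smul c, ?_⟩
    filter_upwards [hu3] with x h1
    have : deriv (c • u).1 x = c * deriv u.1 x := by
      simpa using deriv_const_smul_field (x := x) c u.1
    rw [this]
    simp only [Prod.smul_snd, Pi.smul_apply, smul_eq_mul, h1]
    ring

/-- `τ y` for a pair `(y, y^[1])`. -/
def tau (u : (ℝ → ℂ) × (ℝ → ℂ)) (x : ℝ) : ℂ :=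
  (1 / (L.r x : ℂ)) * (-deriv u.2 x + (L.q x : ℂ) * u.1 x)

/-- `(y, y^[1])` is a solution of `-(y^[1])' + q y = z r y`. -/
def IsSolution (z : ℂ) (u : (ℝ → ℂ) × (ℝ → ℂ)) : Prop :=
  u ∈ L.pairs ∧ ∀ᵐ x ∂(volume.restrict (Ioo L.a L.b)),
    -deriv u.2 x + (L.q x : ℂ) * u.1 x = z * (L.r x : ℂ) * u.1 x

lemma ae_of_ae_mu {P : ℝ → Prop} (h : ∀ᵐ x ∂L.μ, P x) :
    ∀ᵐ x ∂(volume.restrict (Ioo L.a L.b)), P x := by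
  have hr : AEMeasurable (fun x => ENNReal.ofReal (L.r x)) (volume.restrict (Ioo L.a L.b)) :=
    (L.r_int.aestronglyMeasurable.aemeasurable).ennreal_ofReal
  rw [μ, ae_withDensity_iff' hr] at h
  filter_upwards [h, L.r_pos] with x h1 h2
  exact h1 (by simpa using h2)

lemma ae_mu_of_ae {P : ℝ → Prop} (h : ∀ᵐ x ∂(volume.restrict (Ioo L.a L.b)), P x) :
    ∀ᵐ x ∂L.μ, P x :=
  (withDensity_absolutelyContinuous _ _).ae_le h

lemma eqOn_zero_of_ae {f : ℝ → ℂ} (hf : AbsolutelyContinuousOnInterval f L.a L.b)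
    (h : ∀ᵐ x ∂(volume.restrict (Ioo L.a L.b)), f x = 0) : EqOn f 0 (Icc L.a L.b) := by
  have hc : ContinuousOn f (Icc L.a L.b) := by
    have := hf.continuousOn
    rwa [uIcc_of_le L.hab.le] at this
  have h' : f =ᵐ[volume.restrict (Icc L.a L.b)] 0 := by
    rw [← restrict_Ioo_eq_restrict_Icc]
    exact h
  exact Measure.eqOn_Icc_of_ae_eq volume L.hab.ne h' hc continuousOn_const

lemma deriv_zero_of_eqOn {f : ℝ → ℂ} (h : EqOn f 0 (Icc L.a L.b)) {x : ℝ}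
    (hx : x ∈ Ioo L.a L.b) : deriv f x = 0 := by
  have : f =ᶠ[nhds x] fun _ => (0 : ℂ) := by
    filter_upwards [Ioo_mem_nhds hx.1 hx.2] with t ht
    exact h (Ioo_subset_Icc_self ht)
  rw [this.deriv_eq, deriv_const]

/-- A class in `L²((a,b); r dx)` determines the pair `(y, y^[1])` on `[a,b]`. -/
lemma pair_eq_zero {u : (ℝ → ℂ) × (ℝ → ℂ)} (hu : u ∈ L.pairs) (h : ∀ᵐ x ∂L.μ, u.1 x = 0) :
    EqOn u.1 0 (Icc L.a L.b) ∧ EqOn u.2 0 (Icc L.a L.b) := by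
  have h1 := L.eqOn_zero_of_ae hu.1 (L.ae_of_ae_mu h)
  refine ⟨h1, L.eqOn_zero_of_ae hu.2.1 ?_⟩
  filter_upwards [hu.2.2, ae_restrict_mem measurableSet_Ioo] with x hx hx'
  rw [hx, L.deriv_zero_of_eqOn h1 hx', mul_zero]

lemma tau_add {u v : (ℝ → ℂ) × (ℝ → ℂ)} (hu : u ∈ L.pairs) (hv : v ∈ L.pairs) :
    L.tau (u + v) =ᵐ[L.μ] L.tau u + L.tau v := by
  apply L.ae_mu_of_ae
  filter_upwards [ae_restrict_of_ae hu.2.1.boundedVariationOn.ae_differentiableAt_of_mem_uIcc,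
    ae_restrict_of_ae hv.2.1.boundedVariationOn.ae_differentiableAt_of_mem_uIcc,
    ae_restrict_mem measurableSet_Ioo] with x h3 h4 hx
  have hx' : x ∈ uIcc L.a L.b := Ioo_subset_Icc_self.trans Icc_subset_uIcc hx
  have : deriv (u + v).2 x = deriv u.2 x + deriv v.2 x := deriv_add (h3 hx') (h4 hx')
  simp only [tau, this, Prod.fst_add, Pi.add_apply]
  ring

lemma tau_smul (c : ℂ) (u : (ℝ → ℂ) × (ℝ → ℂ)) : L.tau (c • u) = c • L.tau u := by
  funext x
  have : deriv (c • u).2 x = c * deriv u.2 x := by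
    simpa using deriv_const_smul_field (x := x) c u.2
  simp only [tau, this, Prod.smul_fst, Pi.smul_apply, smul_eq_mul]
  ring

lemma tau_congr {u v : (ℝ → ℂ) × (ℝ → ℂ)} (hu : u ∈ L.pairs) (hv : v ∈ L.pairs)
    (h : u.1 =ᵐ[L.μ] v.1) : L.tau u =ᵐ[L.μ] L.tau v := by
  have hw : u + (-1 : ℂ) • v ∈ L.pairs := L.pairs.add_mem hu (L.pairs.smul_mem _ hv)
  obtain ⟨h1, h2⟩ := L.pair_eq_zero hw (by
    filter_upwards [h] with x hx
    simp [hx])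
  have hz : L.tau (u + (-1 : ℂ) • v) =ᵐ[L.μ] 0 := by
    apply L.ae_mu_of_ae
    filter_upwards [ae_restrict_mem measurableSet_Ioo] with x hx
    rw [tau, L.deriv_zero_of_eqOn h2 hx, h1 (Ioo_subset_Icc_self hx)]
    simp
  have ha := L.tau_add hu (L.pairs.smul_mem (-1 : ℂ) hv)
  filter_upwards [hz, ha] with x hx1 hx2
  rw [hx1, tau_smul] at hx2
  simp only [Pi.zero_apply, Pi.add_apply, Pi.smul_apply, smul_eq_mul] at hx2
  linear_combination -hx2

/-- The domain of the maximal operator: all `g ∈ L²((a,b); r dx)` with `g, g^[1] ∈ AC([a,b])` and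
`τ g ∈ L²((a,b); r dx)`. -/
def maxDomain : Submodule ℂ L.Space where
  carrier := {f | ∃ u ∈ L.pairs, f =ᵐ[L.μ] u.1 ∧ MemLp (L.tau u) 2 L.μ}
  zero_mem' := by
    refine ⟨0, L.pairs.zero_mem, Lp.coeFn_zero _ _ _, ?_⟩
    have : L.tau 0 = 0 := by simpa using L.tau_smul 0 0
    rw [this]
    exact MemLp.zero
  add_mem' := by
    rintro f g ⟨u, hu, hf, hu'⟩ ⟨v, hv, hg, hv'⟩
    refine ⟨u + v, L.pairs.add_mem hu hv, ?_, (hu'.add hv').ae_eq (L.tau_add hu hv).symm⟩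
    exact (Lp.coeFn_add f g).trans (hf.add hg)
  smul_mem' := by
    rintro c f ⟨u, hu, hf, hu'⟩
    refine ⟨c • u, L.pairs.smul_mem c hu, ?_, ?_⟩
    · exact (Lp.coeFn_smul c f).trans (hf.const_smul c)
    · rw [tau_smul]
      exact hu'.const_smul c

/-- The pair `(g, g^[1])` of an element `g` of the maximal domain (unique on `[a,b]`). -/
def rep (f : L.maxDomain) : (ℝ → ℂ) × (ℝ → ℂ) := f.2.choose

lemma rep_mem (f : L.maxDomain) : L.rep f ∈ L.pairs := f.2.choose_spec.1

lemma rep_ae (f : L.maxDomain) : (f : L.Space) =ᵐ[L.μ] (L.rep f).1 := f.2.choose_spec.2.1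

lemma rep_memLp (f : L.maxDomain) : MemLp (L.tau (L.rep f)) 2 L.μ := f.2.choose_spec.2.2

/-- The boundary values `((y(a), y^[1](a)), (y(b), y^[1](b)))` of a pair `(y, y^[1])`. -/
def bvals : ((ℝ → ℂ) × (ℝ → ℂ)) →ₗ[ℂ] (Fin 2 → ℂ) × (Fin 2 → ℂ) where
  toFun u := (![u.1 L.a, u.2 L.a], ![u.1 L.b, u.2 L.b])
  map_add' u v := by ext i <;> fin_cases i <;> simp
  map_smul' c u := by ext i <;> fin_cases i <;> simp

lemma bvals_congr {u v : (ℝ → ℂ) × (ℝ → ℂ)} (hu : u ∈ L.pairs) (hv : v ∈ L.pairs)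
    (h : u.1 =ᵐ[L.μ] v.1) : L.bvals u = L.bvals v := by
  have hw : u - v ∈ L.pairs := L.pairs.sub_mem hu hv
  obtain ⟨h1, h2⟩ := L.pair_eq_zero hw (by
    filter_upwards [h] with x hx
    simp [hx])
  have ha : L.a ∈ Icc L.a L.b := left_mem_Icc.2 L.hab.le
  have hb : L.b ∈ Icc L.a L.b := right_mem_Icc.2 L.hab.le
  rw [← sub_eq_zero, ← map_sub]
  have e1 := h1 ha
  have e2 := h1 hb
  have e3 := h2 ha
  have e4 := h2 hb
  simp only [Pi.zero_apply] at e1 e2 e3 e4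
  simp only [bvals, LinearMap.coe_mk, AddHom.coe_mk, e1, e2, e3, e4]
  ext i <;> fin_cases i <;> rfl

lemma rep_add_ae (f g : L.maxDomain) :
    (L.rep (f + g)).1 =ᵐ[L.μ] (L.rep f + L.rep g).1 :=
  (L.rep_ae (f + g)).symm.trans ((Lp.coeFn_add (f : L.Space) (g : L.Space)).trans
    ((L.rep_ae f).add (L.rep_ae g)))

lemma rep_smul_ae (c : ℂ) (f : L.maxDomain) :
    (L.rep (c • f)).1 =ᵐ[L.μ] (c • L.rep f).1 :=
  (L.rep_ae (c • f)).symm.trans ((Lp.coeFn_smul c (f : L.Space)).trans ((L.rep_ae f).const_smul c))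

/-- The boundary values of an element of the maximal domain. -/
def bvalsMax : L.maxDomain →ₗ[ℂ] (Fin 2 → ℂ) × (Fin 2 → ℂ) where
  toFun f := L.bvals (L.rep f)
  map_add' f g := by
    rw [L.bvals_congr (L.rep_mem _) (L.pairs.add_mem (L.rep_mem f) (L.rep_mem g))
      (L.rep_add_ae f g), map_add]
  map_smul' c f := by
    rw [L.bvals_congr (L.rep_mem _) (L.pairs.smul_mem c (L.rep_mem f)) (L.rep_smul_ae c f),
      map_smul, RingHom.id_apply]

/-- The maximal operator `H_max f = τ f`. -/
def Hmax : L.Space →ₗ.[ℂ] L.Space where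
  domain := L.maxDomain
  toFun :=
    { toFun := fun f => (L.rep_memLp f).toLp (L.tau (L.rep f))
      map_add' := fun f g => by
        rw [← MemLp.toLp_add (L.rep_memLp f) (L.rep_memLp g)]
        apply MemLp.toLp_congr
        exact (L.tau_congr (L.rep_mem _) (L.pairs.add_mem (L.rep_mem f) (L.rep_mem g))
          (L.rep_add_ae f g)).trans (L.tau_add (L.rep_mem f) (L.rep_mem g))
      map_smul' := fun c f => by
        rw [RingHom.id_apply, ← MemLp.toLp_const_smul c (L.rep_memLp f)]
        apply MemLp.toLp_congr
        rw [← tau_smul]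
        exact L.tau_congr (L.rep_mem _) (L.pairs.smul_mem c (L.rep_mem f)) (L.rep_smul_ae c f) }

/-- The minimal operator: the restriction of `H_max` to
`g(a) = g^[1](a) = g(b) = g^[1](b) = 0`. -/
def Hmin : L.Space →ₗ.[ℂ] L.Space :=
  L.Hmax.domRestrict ((LinearMap.ker L.bvalsMax).map L.maxDomain.subtype)

end SturmLiouville

/-- The conditions `rank (A B) = 2` and `A J A* = B J B*` on a pair of boundary matrices. -/
def IsBoundaryPair (A B : Matrix (Fin 2) (Fin 2) ℂ) : Prop :=
  (Matrix.fromCols A B).rank = 2 ∧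
    A * !![0, -1; 1, 0] * Aᴴ = B * !![0, -1; 1, 0] * Bᴴ

/-- The boundary trace map `γ_{A,B}`, as a function of the boundary values
`v = (y(a), y^[1](a))` and `w = (y(b), y^[1](b))`: `γ_{A,B} y = A v - B w`. -/
def gammaAB (A B : Matrix (Fin 2) (Fin 2) ℂ) :
    (Fin 2 → ℂ) × (Fin 2 → ℂ) →ₗ[ℂ] EuclideanSpace ℂ (Fin 2) where
  toFun v := WithLp.toLp 2 (A *ᵥ v.1 - B *ᵥ v.2)
  map_add' v w := by
    simp only [Prod.fst_add, Prod.snd_add, Matrix.mulVec_add, ← WithLp.toLp_add]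
    congr 1
    abel
  map_smul' c v := by
    simp only [Prod.smul_fst, Prod.smul_snd, Matrix.mulVec_smul, ← smul_sub, WithLp.toLp_smul,
      RingHom.id_apply]

/-- The Dirichlet trace `γ_D y = (y(a), y(b))`. -/
def gammaD : (Fin 2 → ℂ) × (Fin 2 → ℂ) →ₗ[ℂ] EuclideanSpace ℂ (Fin 2) where
  toFun v := WithLp.toLp 2 ![v.1 0, v.2 0]
  map_add' v w := by ext i; fin_cases i <;> simp
  map_smul' c v := by ext i; fin_cases i <;> simp

/-- The Neumann trace `γ_N y = (y^[1](a), -y^[1](b))`. -/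
def gammaN : (Fin 2 → ℂ) × (Fin 2 → ℂ) →ₗ[ℂ] EuclideanSpace ℂ (Fin 2) where
  toFun v := WithLp.toLp 2 ![v.1 1, -v.2 1]
  map_add' v w := by ext i; fin_cases i <;> simp [add_comm]
  map_smul' c v := by ext i; fin_cases i <;> simp

/-- The matrix `D_{A,B}` in `γ_{A,B} = D_{A,B} γ_D + N_{A,B} γ_N`. -/
def matD (A B : Matrix (Fin 2) (Fin 2) ℂ) : Matrix (Fin 2) (Fin 2) ℂ :=
  !![A 0 0, -B 0 0; A 1 0, -B 1 0]

/-- The matrix `N_{A,B}` in `γ_{A,B} = D_{A,B} γ_D + N_{A,B} γ_N`. -/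
def matN (A B : Matrix (Fin 2) (Fin 2) ℂ) : Matrix (Fin 2) (Fin 2) ℂ :=
  !![A 0 1, B 0 1; A 1 1, B 1 1]

/-- `D^⊥_{A,B} = -[D D* + N N*]⁻¹ N`. -/
def matDperp (A B : Matrix (Fin 2) (Fin 2) ℂ) : Matrix (Fin 2) (Fin 2) ℂ :=
  -((matD A B * (matD A B)ᴴ + matN A B * (matN A B)ᴴ)⁻¹ * matN A B)

/-- `N^⊥_{A,B} = [D D* + N N*]⁻¹ D`. -/
def matNperp (A B : Matrix (Fin 2) (Fin 2) ℂ) : Matrix (Fin 2) (Fin 2) ℂ :=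
  (matD A B * (matD A B)ᴴ + matN A B * (matN A B)ᴴ)⁻¹ * matD A B

/-- The complementary trace map `γ^⊥_{A,B} = D^⊥_{A,B} γ_D + N^⊥_{A,B} γ_N`. -/
def gammaPerp (A B : Matrix (Fin 2) (Fin 2) ℂ) :
    (Fin 2 → ℂ) × (Fin 2 → ℂ) →ₗ[ℂ] EuclideanSpace ℂ (Fin 2) :=
  (Matrix.toEuclideanLin (matDperp A B)) ∘ₗ gammaD +
    (Matrix.toEuclideanLin (matNperp A B)) ∘ₗ gammaN

/-- `S_{A',B',A,B} = N_{A',B'} D_{A,B}* - D_{A',B'} N_{A,B}*`. -/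
def matS (A' B' A B : Matrix (Fin 2) (Fin 2) ℂ) : Matrix (Fin 2) (Fin 2) ℂ :=
  matN A' B' * (matD A B)ᴴ - matD A' B' * (matN A B)ᴴ

/-- `R` is a bounded everywhere defined two-sided inverse of `T - z`. -/
def IsResolventAt {E : Type*} [NormedAddCommGroup E] [NormedSpace ℂ E] (T : E →ₗ.[ℂ] E) (z : ℂ)
    (R : E →L[ℂ] E) : Prop :=
  (∀ f : E, ∃ h : R f ∈ T.domain, T ⟨R f, h⟩ - z • R f = f) ∧
    ∀ g : T.domain, R (T g - z • (g : E)) = g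

/-- The resolvent set `ρ(T)` of an unbounded operator. -/
def pmapResolventSet {E : Type*} [NormedAddCommGroup E] [NormedSpace ℂ E] (T : E →ₗ.[ℂ] E) :
    Set ℂ :=
  {z | ∃ R : E →L[ℂ] E, IsResolventAt T z R}

open Classical in
/-- The resolvent `(T - z)⁻¹` for `z ∈ ρ(T)` (and `0` otherwise). -/
def pmapResolvent {E : Type*} [NormedAddCommGroup E] [NormedSpace ℂ E] (T : E →ₗ.[ℂ] E) (z : ℂ) :
    E →L[ℂ] E :=
  if h : ∃ R : E →L[ℂ] E, IsResolventAt T z R then h.choose else 0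

namespace SturmLiouville

variable (L : SturmLiouville)

/-- The operator `H_{A,B}`: the restriction of `H_max` to `{g ∈ dom H_max | γ_{A,B} g = 0}`. -/
def H (A B : Matrix (Fin 2) (Fin 2) ℂ) : L.Space →ₗ.[ℂ] L.Space :=
  L.Hmax.domRestrict ((LinearMap.ker (gammaAB A B ∘ₗ L.bvalsMax)).map L.maxDomain.subtype)

/-- The bounded operator `G` is the composition `γ (H_{A,B} - z)⁻¹`. -/
def IsTraceResolvent (γ : (Fin 2 → ℂ) × (Fin 2 → ℂ) →ₗ[ℂ] EuclideanSpace ℂ (Fin 2))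
    (A B : Matrix (Fin 2) (Fin 2) ℂ) (z : ℂ) (G : L.Space →L[ℂ] EuclideanSpace ℂ (Fin 2)) : Prop :=
  ∀ f : L.Space, ∃ h : pmapResolvent (L.H A B) z f ∈ L.maxDomain,
    G f = γ (L.bvalsMax ⟨pmapResolvent (L.H A B) z f, h⟩)

open Classical in
/-- The bounded operator `γ (H_{A,B} - z)⁻¹` from `L²((a,b); r dx)` to `ℂ²`
(and `0` if there is no such bounded operator). -/
def traceResolvent (γ : (Fin 2 → ℂ) × (Fin 2 → ℂ) →ₗ[ℂ] EuclideanSpace ℂ (Fin 2))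
    (A B : Matrix (Fin 2) (Fin 2) ℂ) (z : ℂ) : L.Space →L[ℂ] EuclideanSpace ℂ (Fin 2) :=
  if h : ∃ G, L.IsTraceResolvent γ A B z G then h.choose else 0

/-- A solution `u_{A,B}(z, · ; c)` of `τ u = z u`, `γ_{A,B} u = c`, together with its
quasi-derivative (arbitrary if there is no solution). -/
def bvpSol (A B : Matrix (Fin 2) (Fin 2) ℂ) (z : ℂ) (c : EuclideanSpace ℂ (Fin 2)) :
    (ℝ → ℂ) × (ℝ → ℂ) :=
  Classical.epsilon fun u => L.IsSolution z u ∧ gammaAB A B (L.bvals u) = c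

/-- The matrix of the boundary data map `Λ_{A,B}^{A',B'}(z) : c ↦ γ_{A',B'} u_{A,B}(z, · ; c)`. -/
def bdm (A B A' B' : Matrix (Fin 2) (Fin 2) ℂ) (z : ℂ) : Matrix (Fin 2) (Fin 2) ℂ :=
  Matrix.of fun i j =>
    gammaAB A' B' (L.bvals (L.bvpSol A B z (EuclideanSpace.single j 1))) i

/-- The boundary value problem `τ u = z u`, `γ_{A,B} u = c` has exactly one solution on `[a,b]` for
every `c`, and the matrix `M` maps `c` to `γ_{A',B'} u`. -/
def IsBoundaryDataMap (A B A' B' : Matrix (Fin 2) (Fin 2) ℂ) (z : ℂ)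
    (M : Matrix (Fin 2) (Fin 2) ℂ) : Prop :=
  (∀ c, ∃ u, L.IsSolution z u ∧ gammaAB A B (L.bvals u) = c) ∧
  (∀ u v, L.IsSolution z u → L.IsSolution z v →
    gammaAB A B (L.bvals u) = gammaAB A B (L.bvals v) → EqOn u.1 v.1 (Icc L.a L.b)) ∧
  ∀ u, L.IsSolution z u →
    gammaAB A' B' (L.bvals u) = Matrix.toEuclideanLin M (gammaAB A B (L.bvals u))

end SturmLiouville

/-- The range of a `2 × 2` matrix, as a subspace of `ℂ²`. -/
abbrev matRan (S : Matrix (Fin 2) (Fin 2) ℂ) : Submodule ℂ (EuclideanSpace ℂ (Fin 2)) :=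
  LinearMap.range (Matrix.toEuclideanLin S)

/-- The compression `P_K M P_K |_K` of a matrix to a subspace `K` of `ℂ²`, as an operator in `K`. -/
def compression (K : Submodule ℂ (EuclideanSpace ℂ (Fin 2))) (M : Matrix (Fin 2) (Fin 2) ℂ) :
    K →L[ℂ] K :=
  K.orthogonalProjectionOnto ∘L Matrix.toEuclideanCLM (𝕜 := ℂ) M ∘L K.starProjection ∘L K.subtypeL

namespace SturmLiouville

variable (L : SturmLiouville)

/-- `λ_{A,B}^{A',B'}(z) = P Λ_{A,B}^{A',B'}(z) S* P |_{ran S}`, where `S = S_{A',B',A,B}` and `P` is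
the orthogonal projection onto `ran S`. -/
def lam (A B A' B' : Matrix (Fin 2) (Fin 2) ℂ) (z : ℂ) :
    matRan (matS A' B' A B) →L[ℂ] matRan (matS A' B' A B) :=
  compression (matRan (matS A' B' A B)) (L.bdm A B A' B' z * (matS A' B' A B)ᴴ)

end SturmLiouville

end

/-! Write γ, γ', γ^⊥ for γ_{A,B}, γ_{A',B'}, γ^⊥_{A,B}, and let K(w)c be the solution of τu = wu
with γu = c. If γv = 0, Green's identity and the algebra of boundary matrices give ⟨H_max v, u⟩ −
⟨v, H_max u⟩ = ⟨γ^⊥v, γu⟩ (`inner_maxMap_sub_inner_maxMap`, `boundary_form_eq`). With u = K(w)c this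
reads γ^⊥v = K(w)*(H_max − w̄)v, so γ^⊥(H_{A,B} − w̄)⁻¹ = K(w)*. Hence this operator is bounded, and
the adjoint in the first formula is K(z) (`IsSolutionMap.gammaPerp_eq`).

Krein's formula is then a correction of boundary values. For v = (H_{A,B} − z)⁻¹f, the function v −
K(z)Λ⁻¹γ'v still satisfies (H_max − z)· = f and lies in ker γ', so it is (H_{A',B'} − z)⁻¹f
(`IsSolutionMap.resolvent_eq`). Moreover γ' = Sγ^⊥ + Xγ with XS* = SX*
(`exists_gammaAB_decomposition`), so γ'v = Sγ^⊥v, which is the first formula.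

The other two use that the adjoint of γ'(H_{A,B} − z̄)⁻¹ is K(z)S*. If S is invertible, KS*(ΛS*)⁻¹ =
KΛ⁻¹. Otherwise ΛS* = S(γ^⊥KS* + X*) maps into ran S, and it is injective there because ran S ⟂ ker
S*; this inverts λ(z).

The analytic input is solvability of the initial value problem. It makes ker(H_max − w) at least
two-dimensional, so K(w) exists as soon as w is not an eigenvalue of H_{A,B}. -/

/-! ### Absolutely continuous functions and the fundamental theorem of calculus. -/

section AbsolutelyContinuous

/-- A function whose increments are dominated by those of an absolutely continuous function is
absolutely continuous. -/
lemma AbsolutelyContinuousOnInterval.of_dist_le {X Y : Type*} [PseudoMetricSpace X]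
    [PseudoMetricSpace Y] {f : ℝ → X} {g : ℝ → Y} {a b : ℝ}
    (hg : AbsolutelyContinuousOnInterval g a b)
    (h : ∀ x ∈ uIcc a b, ∀ y ∈ uIcc a b, dist (f x) (f y) ≤ dist (g x) (g y)) :
    AbsolutelyContinuousOnInterval f a b := by
  rw [absolutelyContinuousOnInterval_iff] at hg ⊢
  intro ε hε
  obtain ⟨δ, hδ, H⟩ := hg ε hε
  refine ⟨δ, hδ, fun E hE hlen => lt_of_le_of_lt ?_ (H E hE hlen)⟩
  refine Finset.sum_le_sum fun i hi => ?_
  exact h _ (hE.1 i hi).1 _ (hE.1 i hi).2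

/-- Increments of the primitive of f are dominated by those of the primitive of ‖f‖, which reduces
the claim to the scalar case. -/
lemma IntervalIntegrable.absolutelyContinuousOnInterval_primitive {E : Type*}
    [NormedAddCommGroup E] [NormedSpace ℝ E] {f : ℝ → E} {a b : ℝ}
    (h : IntervalIntegrable f volume a b) :
    AbsolutelyContinuousOnInterval (fun x => ∫ t in a..x, f t) a b := by
  refine (h.norm.absolutelyContinuousOnInterval_intervalIntegral
    (c := a) left_mem_uIcc).of_dist_le fun x hx y hy => ?_
  have hax := h.mono_set (uIcc_subset_uIcc_left hx)
  have hay := h.mono_set (uIcc_subset_uIcc_left hy)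
  rw [dist_eq_norm, dist_eq_norm, intervalIntegral.integral_interval_sub_left hax hay,
    intervalIntegral.integral_interval_sub_left hax.norm hay.norm, Real.norm_eq_abs]
  exact intervalIntegral.norm_integral_le_abs_integral_norm

/-- The fundamental theorem of calculus for absolutely continuous functions. -/
lemma AbsolutelyContinuousOnInterval.integral_eq_sub_of_ae_hasDerivAt {E : Type*}
    [NormedAddCommGroup E] [NormedSpace ℝ E] [CompleteSpace E] {f f' : ℝ → E} {a b : ℝ}
    (hf : AbsolutelyContinuousOnInterval f a b) (hi : IntervalIntegrable f' volume a b)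
    (hd : ∀ᵐ x, x ∈ uIcc a b → HasDerivAt f (f' x) x) :
    ∫ x in a..b, f' x = f b - f a := by
  -- f minus the primitive of f' is absolutely continuous with a.e. zero derivative, hence constant.
  obtain ⟨C, hC⟩ := (hf.fun_sub
    hi.absolutelyContinuousOnInterval_primitive).const_of_ae_hasDerivAt_zero (by
      filter_upwards [hd, hi.ae_hasDerivAt_integral] with x h1 h2 hx
      simpa using (h1 hx).fun_sub (h2 hx a left_mem_uIcc))
  have h1 := hC a left_mem_uIcc
  have h2 := hC b right_mem_uIcc
  simp only [intervalIntegral.integral_same, sub_zero] at h1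
  rw [h1, ← h2]
  abel

end AbsolutelyContinuous

/-! ### Volterra equations with integrable kernel. -/

section Volterra

variable {E : Type*} [NormedAddCommGroup E] [NormedSpace ℝ E]

/-- Kernels are cut off to the left of a, so that the estimates hold on all of ℝ and bounded
continuous functions on ℝ can serve as the Banach space. -/
lemma intervalIntegral_eq_zero_of_le {a x : ℝ} {f : ℝ → E} (h : ∀ t < a, f t = 0) (hx : x ≤ a) :
    ∫ t in a..x, f t = 0 := by
  rw [intervalIntegral.integral_symm, intervalIntegral.integral_of_le hx, neg_eq_zero,
    integral_Ioc_eq_integral_Ioo]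
  exact setIntegral_eq_zero_of_forall_eq_zero fun t ht => h t ht.2

lemma integrable_clm_apply_of_bounded {M : ℝ → E →L[ℝ] E} (hM : Integrable M) {g : ℝ → E}
    (hg : Continuous g) {C : ℝ} (hC : ∀ x, ‖g x‖ ≤ C) : Integrable fun t => M t (g t) := by
  refine (hM.norm.mul_const C).mono'
    ((ContinuousLinearMap.id ℝ (E →L[ℝ] E)).aestronglyMeasurable_comp₂
      hM.aestronglyMeasurable hg.aestronglyMeasurable) ?_
  refine Filter.Eventually.of_forall fun t => ?_
  exact (M t).le_opNorm_of_le (hC t)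

/-- `2 ∫ₐˣ k(t) exp(2 ∫ₐᵗ k) dt = exp(2 ∫ₐˣ k) - 1`. -/
lemma integral_mul_exp_primitive {k : ℝ → ℝ} (hk : Integrable k) (a x : ℝ) :
    ∫ t in a..x, k t * Real.exp (2 * ∫ s in a..t, k s) =
      (Real.exp (2 * ∫ s in a..x, k s) - 1) / 2 := by
  have hk' : IntervalIntegrable k volume a x := hk.intervalIntegrable
  have hac := hk'.absolutelyContinuousOnInterval_primitive
  have hcont : Continuous fun t => ∫ s in a..t, k s :=
    intervalIntegral.continuous_primitive (fun _ _ => hk.intervalIntegrable) a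
  have hexp : AbsolutelyContinuousOnInterval
      (fun t => Real.exp (2 * ∫ s in a..t, k s)) a x := by
    obtain ⟨C, hC⟩ := hac.exists_bound
    -- The exponential is Lipschitz on the bounded range of the primitive, so composing with it
    -- preserves absolute continuity.
    have hlip : ∀ u ∈ Icc (-C) C, ∀ v ∈ Icc (-C) C,
        dist (Real.exp (2 * u)) (Real.exp (2 * v)) ≤ 2 * Real.exp (2 * C) * dist u v := by
      intro u hu v hv
      rw [dist_eq_norm, dist_eq_norm]
      refine (convex_Icc (-C) C).norm_image_sub_le_of_norm_hasDerivWithin_le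
        (f := fun u => Real.exp (2 * u)) (f' := fun u => Real.exp (2 * u) * 2)
        (fun y _ => ?_) (fun y hy => ?_) hv hu
      · simpa using (((hasDerivAt_id y).const_mul 2).exp).hasDerivWithinAt
      · rw [Real.norm_eq_abs, abs_of_nonneg (by positivity), mul_comm]
        gcongr
        exact hy.2
    refine (hac.const_mul (2 * Real.exp (2 * C))).of_dist_le fun u hu v hv => ?_
    refine (hlip _ (abs_le.1 (hC u hu)) _ (abs_le.1 (hC v hv))).trans (le_of_eq ?_)
    rw [Real.dist_eq, Real.dist_eq, ← mul_sub, abs_mul,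
      abs_of_nonneg (a := 2 * Real.exp (2 * C)) (by positivity)]
  have hii : IntervalIntegrable (fun t => k t * Real.exp (2 * ∫ s in a..t, k s)) volume a x :=
    hk'.mul_continuousOn (by fun_prop)
  have := hexp.integral_eq_sub_of_ae_hasDerivAt (hii.const_mul 2) (by
    filter_upwards [hk'.ae_hasDerivAt_integral] with t ht hx
    refine ((ht hx a left_mem_uIcc).const_mul 2).exp.congr_deriv ?_
    ring)
  rw [intervalIntegral.integral_const_mul] at this
  simp only [intervalIntegral.integral_same, mul_zero, Real.exp_zero] at this
  linarith

/-- Solvability of linear Volterra equations with integrable kernel `M(t)`. -/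
theorem exists_volterra_solution [CompleteSpace E] {a : ℝ} {M : ℝ → E →L[ℝ] E} (hM : Integrable M)
    (h0 : ∀ t < a, M t = 0) {Φ : ℝ → E} (hΦ : Continuous Φ) {C : ℝ} (hC : ∀ x, ‖Φ x‖ ≤ C) :
    ∃ Y : ℝ → E, Continuous Y ∧ (∃ C', ∀ x, ‖Y x‖ ≤ C') ∧
      ∀ x, Y x = Φ x + ∫ t in a..x, M t (Y t) := by
  -- Bielecki's weight: measured against w = exp(2m), the integral operator has norm at most 1/2,
  -- however large the kernel is; the 2 in the exponent produces this 1/2.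
  set m : ℝ → ℝ := fun x => ∫ t in a..x, ‖M t‖ with hm
  set w : ℝ → ℝ := fun x => Real.exp (2 * m x) with hw
  have hmc : Continuous m :=
    intervalIntegral.continuous_primitive (fun _ _ => hM.norm.intervalIntegrable) a
  have hwc : Continuous w := by fun_prop
  have hm0 : ∀ x, 0 ≤ m x := fun x => by
    rcases le_total a x with hx | hx
    · exact intervalIntegral.integral_nonneg hx fun _ _ => norm_nonneg _
    · exact (intervalIntegral_eq_zero_of_le (fun t ht => by simp [h0 t ht]) hx).ge
  have hm1 : ∀ x, m x ≤ ∫ t, ‖M t‖ := fun x => by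
    rcases le_total a x with hx | hx
    · rw [hm]
      simp only
      rw [intervalIntegral.integral_of_le hx]
      exact setIntegral_le_integral hM.norm (Filter.Eventually.of_forall fun _ => norm_nonneg _)
    · exact (intervalIntegral_eq_zero_of_le (fun t ht => by simp [h0 t ht]) hx).le.trans
        (integral_nonneg fun _ => norm_nonneg _)
  have hw1 : ∀ x, 1 ≤ w x := fun x => Real.one_le_exp (by have := hm0 x; positivity)
  have hwp : ∀ x, 0 < w x := fun x => Real.exp_pos _
  set W : ℝ := Real.exp (2 * ∫ t, ‖M t‖) with hW
  have hwW : ∀ x, w x ≤ W := fun x => Real.exp_le_exp.2 (by have := hm1 x; linarith)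
  have hint : ∀ Z : BoundedContinuousFunction ℝ E, Integrable fun t => M t (w t • Z t) := fun Z =>
    integrable_clm_apply_of_bounded hM (hwc.smul Z.continuous) (C := W * ‖Z‖) fun x => by
      rw [norm_smul, Real.norm_of_nonneg (hwp x).le]
      exact mul_le_mul (hwW x) (Z.norm_coe_le_norm x) (norm_nonneg _) (Real.exp_pos _).le
  have hbd : ∀ (Z : BoundedContinuousFunction ℝ E) x,
      ‖∫ t in a..x, M t (w t • Z t)‖ ≤ w x * (‖Z‖ / 2) := by
    intro Z x
    rcases le_total a x with hx | hx
    · have h1 : ‖∫ t in a..x, M t (w t • Z t)‖ ≤ ∫ t in a..x, ‖M t‖ * w t * ‖Z‖ := by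
        refine intervalIntegral.norm_integral_le_of_norm_le hx
          (Filter.Eventually.of_forall fun t _ => ?_) ?_
        · refine (M t).le_opNorm_of_le ?_ |>.trans_eq (mul_assoc _ _ _).symm
          rw [norm_smul, Real.norm_of_nonneg (hwp t).le]
          exact mul_le_mul_of_nonneg_left (Z.norm_coe_le_norm t) (hwp t).le
        · exact (hM.norm.intervalIntegrable.mul_continuousOn hwc.continuousOn).mul_const _
      rw [intervalIntegral.integral_mul_const, integral_mul_exp_primitive hM.norm] at h1
      refine h1.trans ?_
      have := norm_nonneg Z
      change (w x - 1) / 2 * ‖Z‖ ≤ _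
      nlinarith
    · rw [intervalIntegral_eq_zero_of_le (fun t ht => by simp [h0 t ht]) hx, norm_zero]
      have := hwp x
      positivity
  -- The unknown is rescaled to Z = Y / w, so the plain sup norm of Z is the weighted norm of Y.
  let T : BoundedContinuousFunction ℝ E → BoundedContinuousFunction ℝ E := fun Z =>
    BoundedContinuousFunction.ofNormedAddCommGroup
      (fun x => (w x)⁻¹ • (Φ x + ∫ t in a..x, M t (w t • Z t)))
      ((hwc.inv₀ fun x => (hwp x).ne').smul (hΦ.add
        (intervalIntegral.continuous_primitive (fun _ _ => (hint Z).intervalIntegrable) a)))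
      (C + ‖Z‖ / 2) (fun x => by
        rw [norm_smul, norm_inv, Real.norm_of_nonneg (hwp x).le, inv_mul_le_iff₀ (hwp x), mul_add]
        refine (norm_add_le _ _).trans (add_le_add ((hC x).trans ?_) (hbd Z x))
        exact le_mul_of_one_le_left ((norm_nonneg _).trans (hC x)) (hw1 x))
  have hT : ContractingWith (1 / 2 : NNReal) T := by
    refine ⟨by rw [← NNReal.coe_lt_coe]; norm_num, LipschitzWith.of_dist_le_mul fun Z Z' => ?_⟩
    refine (BoundedContinuousFunction.dist_le (by positivity)).2 fun x => ?_
    have e : T Z x - T Z' x = (w x)⁻¹ • ∫ t in a..x, M t (w t • (Z - Z') t) := by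
      change (w x)⁻¹ • (Φ x + ∫ t in a..x, M t (w t • Z t)) -
        (w x)⁻¹ • (Φ x + ∫ t in a..x, M t (w t • Z' t)) = _
      rw [← smul_sub, add_sub_add_left_eq_sub, ← intervalIntegral.integral_sub
        (hint Z).intervalIntegrable (hint Z').intervalIntegrable]
      simp [smul_sub]
    rw [dist_eq_norm, e, norm_smul, norm_inv, Real.norm_of_nonneg (hwp x).le,
      inv_mul_le_iff₀ (hwp x), dist_eq_norm]
    refine (hbd _ x).trans (le_of_eq ?_)
    push_cast
    ring
  obtain ⟨Z, hZ⟩ : ∃ Z, T Z = Z := ⟨_, hT.fixedPoint_isFixedPt⟩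
  refine ⟨fun x => w x • Z x, hwc.smul Z.continuous, ⟨W * ‖Z‖, fun x => ?_⟩, fun x => ?_⟩
  · rw [norm_smul, Real.norm_of_nonneg (hwp x).le]
    exact mul_le_mul (hwW x) (Z.norm_coe_le_norm x) (norm_nonneg _) (Real.exp_pos _).le
  · have : Z x = (w x)⁻¹ • (Φ x + ∫ t in a..x, M t (w t • Z t)) := by
      conv_lhs => rw [← hZ]
      rfl
    change w x • Z x = _
    rw [this, smul_inv_smul₀ (hwp x).ne']

end Volterra

/-! ### The initial value problem. -/

section InitialValueProblem

lemma norm_intervalIntegral_le_integral_norm {E : Type*} [NormedAddCommGroup E] [NormedSpace ℝ E]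
    {f : ℝ → E} (hf : Integrable f) (a x : ℝ) : ‖∫ t in a..x, f t‖ ≤ ∫ t, ‖f t‖ :=
  intervalIntegral.norm_integral_le_integral_norm_uIoc.trans
    (setIntegral_le_integral hf.norm (Filter.Eventually.of_forall fun _ => norm_nonneg _))

/-- Solvability of `y' = P z`, `z' = Q y - G` with integrable coefficients. -/
theorem exists_integral_system {a b : ℝ} {P Q G : ℝ → ℂ}
    (hP : IntegrableOn P (Ioo a b)) (hQ : IntegrableOn Q (Ioo a b)) (hG : IntegrableOn G (Ioo a b))
    (η : Fin 2 → ℂ) :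
    ∃ y z : ℝ → ℂ, Continuous y ∧ Continuous z ∧
      (∀ x, y x = η 0 + ∫ t in a..x, (Ioo a b).indicator (fun t => P t * z t) t) ∧
      ∀ x, z x = η 1 + ∫ t in a..x, (Ioo a b).indicator (fun t => Q t * y t - G t) t := by
  -- The system is Y' = MY − (0, G) with off-diagonal M; the primitive of G is absorbed into the
  -- inhomogeneity Φ, which is bounded because G is integrable.
  let e12 : ℂ × ℂ →L[ℝ] ℂ × ℂ := ContinuousLinearMap.inl ℝ ℂ ℂ ∘L ContinuousLinearMap.snd ℝ ℂ ℂ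
  let e21 : ℂ × ℂ →L[ℝ] ℂ × ℂ := ContinuousLinearMap.inr ℝ ℂ ℂ ∘L ContinuousLinearMap.fst ℝ ℂ ℂ
  have hP' := (integrable_indicator_iff measurableSet_Ioo).2 hP
  have hQ' := (integrable_indicator_iff measurableSet_Ioo).2 hQ
  have hG' := (integrable_indicator_iff measurableSet_Ioo).2 hG
  let M : ℝ → ℂ × ℂ →L[ℝ] ℂ × ℂ := fun t =>
    (Ioo a b).indicator P t • e12 + (Ioo a b).indicator Q t • e21
  have hM : Integrable M := (hP'.smul_const e12).add (hQ'.smul_const e21)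
  have hM0 : ∀ t < a, M t = 0 := fun t ht => by
    have : t ∉ Ioo a b := fun h => (h.1.trans ht).false
    ext v <;> simp [M, this]
  obtain ⟨Y, hYc, ⟨C', hC'⟩, hY⟩ := exists_volterra_solution hM hM0
    (Φ := fun x => (η 0, η 1 - ∫ t in a..x, (Ioo a b).indicator G t))
    (continuous_const.prodMk (continuous_const.sub
      (intervalIntegral.continuous_primitive (fun _ _ => hG'.intervalIntegrable) a)))
    (C := max ‖η 0‖ (‖η 1‖ + ∫ t, ‖(Ioo a b).indicator G t‖)) (fun x => by
      refine max_le_max le_rfl ((norm_sub_le _ _).trans (add_le_add le_rfl ?_))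
      exact norm_intervalIntegral_le_integral_norm hG' a x)
  have hMY := integrable_clm_apply_of_bounded hM hYc hC'
  refine ⟨fun x => (Y x).1, fun x => (Y x).2, continuous_fst.comp hYc, continuous_snd.comp hYc,
    fun x => ?_, fun x => ?_⟩
  · have h1 := congrArg Prod.fst (hY x)
    have h2 : ∫ t in a..x, (M t (Y t)).1 = (∫ t in a..x, M t (Y t)).1 :=
      (ContinuousLinearMap.fst ℝ ℂ ℂ).intervalIntegral_comp_comm hMY.intervalIntegrable
    rw [Prod.fst_add, ← h2] at h1
    refine h1.trans (congrArg (η 0 + ·) (intervalIntegral.integral_congr fun t _ => ?_))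
    by_cases ht : t ∈ Ioo a b <;> simp [M, e12, e21, ht]
  · have h1 := congrArg Prod.snd (hY x)
    have h2 : ∫ t in a..x, (M t (Y t)).2 = (∫ t in a..x, M t (Y t)).2 :=
      (ContinuousLinearMap.snd ℝ ℂ ℂ).intervalIntegral_comp_comm hMY.intervalIntegrable
    have hMY2 : Integrable fun t => (M t (Y t)).2 :=
      (ContinuousLinearMap.snd ℝ ℂ ℂ).integrable_comp hMY
    rw [Prod.snd_add, ← h2, sub_add, ← intervalIntegral.integral_sub hG'.intervalIntegrable
      hMY2.intervalIntegrable, sub_eq_add_neg, ← intervalIntegral.integral_neg] at h1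
    refine h1.trans (congrArg (η 1 + ·) (intervalIntegral.integral_congr fun t _ => ?_))
    by_cases ht : t ∈ Ioo a b <;> simp [M, e12, e21, ht]

end InitialValueProblem

namespace SturmLiouville

variable (L : SturmLiouville)

/-- Lebesgue differentiation turns the integral equations back into differential equations a.e. -/
lemma ae_hasDerivAt_of_primitive {y k : ℝ → ℂ} {c : ℂ} (hk : IntegrableOn k (Ioo L.a L.b))
    (h : ∀ x, y x = c + ∫ t in L.a..x, (Ioo L.a L.b).indicator k t) :
    AbsolutelyContinuousOnInterval y L.a L.b ∧
      ∀ᵐ x ∂(volume.restrict (Ioo L.a L.b)), deriv y x = k x := by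
  have hi : IntervalIntegrable ((Ioo L.a L.b).indicator k) volume L.a L.b :=
    ((integrable_indicator_iff measurableSet_Ioo).2 hk).intervalIntegrable
  have hy : y = fun x => c + ∫ t in L.a..x, (Ioo L.a L.b).indicator k t := funext h
  refine ⟨hi.absolutelyContinuousOnInterval_primitive.of_dist_le fun x _ z _ => by simp [hy], ?_⟩
  filter_upwards [ae_restrict_of_ae hi.ae_hasDerivAt_integral, ae_restrict_mem measurableSet_Ioo]
    with x hx hx'
  have := (hx (Ioo_subset_Icc_self.trans Icc_subset_uIcc hx') L.a left_mem_uIcc).const_add c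
  rw [indicator_of_mem hx'] at this
  rw [hy]
  exact this.deriv

lemma integrableOn_mul_continuous {k y : ℝ → ℂ} (hk : IntegrableOn k (Ioo L.a L.b))
    (hy : Continuous y) : IntegrableOn (fun x => k x * y x) (Ioo L.a L.b) := by
  rw [← integrableOn_Icc_iff_integrableOn_Ioo] at hk ⊢
  exact hk.mul_continuousOn hy.continuousOn isCompact_Icc

/-- The initial value problem `-(y^[1])' + q y = w r y + g`, `(y(a), y^[1](a)) = η` is solvable. -/
theorem exists_initial_value_problem (w : ℂ) {g : ℝ → ℂ} (hg : IntegrableOn g (Ioo L.a L.b))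
    (η : Fin 2 → ℂ) : ∃ u ∈ L.pairs, (L.bvals u).1 = η ∧
      ∀ᵐ x ∂(volume.restrict (Ioo L.a L.b)),
        -deriv u.2 x + (L.q x : ℂ) * u.1 x = w * (L.r x : ℂ) * u.1 x + g x := by
  -- With z = y^[1] the equation is y' = z / p, z' = (q − wr)y − g.
  have hP : IntegrableOn (fun x => ((1 / L.p x : ℝ) : ℂ)) (Ioo L.a L.b) := L.p_inv_int.ofReal
  have hQ : IntegrableOn (fun x => (L.q x : ℂ) - w * (L.r x : ℂ)) (Ioo L.a L.b) :=
    L.q_int.ofReal.sub (L.r_int.ofReal.const_mul w)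
  obtain ⟨y, z, hy, hz, hy', hz'⟩ := exists_integral_system hP hQ hg η
  obtain ⟨acy, dy⟩ := L.ae_hasDerivAt_of_primitive (L.integrableOn_mul_continuous hP hz) hy'
  obtain ⟨acz, dz⟩ := L.ae_hasDerivAt_of_primitive
    ((L.integrableOn_mul_continuous hQ hy).sub hg) hz'
  refine ⟨(y, z), ⟨acy, acz, ?_⟩, ?_, ?_⟩
  · filter_upwards [dy, L.p_pos] with x hx hp
    rw [hx]
    have : (L.p x : ℂ) ≠ 0 := by exact_mod_cast hp.ne'
    push_cast
    field_simp
  · have h1 := hy' L.a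
    have h2 := hz' L.a
    simp only [intervalIntegral.integral_same, add_zero] at h1 h2
    ext i
    fin_cases i <;> simp [bvals, h1, h2]
  · filter_upwards [dz] with x hx
    simp only [Pi.sub_apply] at hx ⊢
    rw [hx]
    ring

end SturmLiouville

/-! ### The maximal operator and Green's identity. -/

noncomputable section

namespace SturmLiouville

variable (L : SturmLiouville)

lemma aemeasurable_weight :
    AEMeasurable (fun x => ENNReal.ofReal (L.r x)) (volume.restrict (Ioo L.a L.b)) :=
  (L.r_int.aestronglyMeasurable.aemeasurable).ennreal_ofReal

instance isFiniteMeasure_mu : IsFiniteMeasure L.μ := by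
  refine isFiniteMeasure_withDensity_ofReal ?_
  exact L.r_int.hasFiniteIntegral

lemma ae_toReal_weight :
    ∀ᵐ x ∂(volume.restrict (Ioo L.a L.b)), (ENNReal.ofReal (L.r x)).toReal = L.r x := by
  filter_upwards [L.r_pos] with x hx
  exact ENNReal.toReal_ofReal hx.le

lemma integrableOn_weight_mul {g : ℝ → ℂ} (hg : Integrable g L.μ) :
    IntegrableOn (fun x => (L.r x : ℂ) * g x) (Ioo L.a L.b) := by
  rw [μ, integrable_withDensity_iff_integrable_smul₀' L.aemeasurable_weight
    (Filter.Eventually.of_forall fun _ => ENNReal.ofReal_lt_top)] at hg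
  refine hg.congr ?_
  filter_upwards [L.ae_toReal_weight] with x hx
  rw [hx, Complex.real_smul]

lemma integral_mu (g : ℝ → ℂ) : ∫ x, g x ∂L.μ = ∫ x in Ioo L.a L.b, (L.r x : ℂ) * g x := by
  rw [μ, integral_withDensity_eq_integral_toReal_smul₀ L.aemeasurable_weight
    (Filter.Eventually.of_forall fun _ => ENNReal.ofReal_lt_top)]
  refine integral_congr_ae ?_
  filter_upwards [L.ae_toReal_weight] with x hx
  rw [hx, Complex.real_smul]

/-- Absolutely continuous functions are bounded and r dx is a finite measure. -/
lemma pairs_memLp {u : (ℝ → ℂ) × (ℝ → ℂ)} (hu : u ∈ L.pairs) : MemLp u.1 2 L.μ := by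
  obtain ⟨C, hC⟩ := hu.1.exists_bound
  have hm : AEStronglyMeasurable u.1 (volume.restrict (Ioo L.a L.b)) :=
    ((hu.1.continuousOn.mono (Ioo_subset_Icc_self.trans Icc_subset_uIcc)).aestronglyMeasurable
      measurableSet_Ioo)
  refine MemLp.of_bound (hm.mono_ac (withDensity_absolutelyContinuous _ _)) C (L.ae_mu_of_ae ?_)
  filter_upwards [ae_restrict_mem measurableSet_Ioo] with x hx
  exact hC x (Ioo_subset_Icc_self.trans Icc_subset_uIcc hx)

/-- The action of `H_max` as a linear map on its domain. -/
def maxMap : L.maxDomain →ₗ[ℂ] L.Space := L.Hmax.toFun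

/-- `Hmax` is defined through a chosen representative; this frees computations from that choice. -/
lemma maxMap_ae (f : L.maxDomain) {u : (ℝ → ℂ) × (ℝ → ℂ)} (hu : u ∈ L.pairs)
    (hf : (f : L.Space) =ᵐ[L.μ] u.1) : L.maxMap f =ᵐ[L.μ] L.tau u :=
  (MemLp.coeFn_toLp (L.rep_memLp f)).trans
    (L.tau_congr (L.rep_mem f) hu ((L.rep_ae f).symm.trans hf))

lemma bvalsMax_eq (f : L.maxDomain) {u : (ℝ → ℂ) × (ℝ → ℂ)} (hu : u ∈ L.pairs)
    (hf : (f : L.Space) =ᵐ[L.μ] u.1) : L.bvalsMax f = L.bvals u :=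
  L.bvals_congr (L.rep_mem f) hu ((L.rep_ae f).symm.trans hf)

/-- A pair solving `-(y^[1])' + q y = r g` with `g ∈ L²` is an element of the maximal domain. -/
lemma exists_maxDomain_of_pair {u : (ℝ → ℂ) × (ℝ → ℂ)} (hu : u ∈ L.pairs) {g : ℝ → ℂ}
    (hg : MemLp g 2 L.μ) (h : ∀ᵐ x ∂(volume.restrict (Ioo L.a L.b)),
      -deriv u.2 x + (L.q x : ℂ) * u.1 x = (L.r x : ℂ) * g x) :
    ∃ f : L.maxDomain, (f : L.Space) =ᵐ[L.μ] u.1 ∧ L.bvalsMax f = L.bvals u ∧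
      L.maxMap f = hg.toLp g := by
  have ht : L.tau u =ᵐ[L.μ] g := by
    apply L.ae_mu_of_ae
    filter_upwards [h, L.r_pos] with x hx hr
    have : (L.r x : ℂ) ≠ 0 := by exact_mod_cast hr.ne'
    rw [tau, hx]
    field_simp
  obtain ⟨F, hF⟩ : ∃ F : L.Space, F =ᵐ[L.μ] u.1 := ⟨_, MemLp.coeFn_toLp (L.pairs_memLp hu)⟩
  obtain ⟨f, rfl⟩ : ∃ f : L.maxDomain, (f : L.Space) = F :=
    ⟨⟨F, u, hu, hF, hg.ae_eq ht.symm⟩, rfl⟩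
  refine ⟨f, hF, L.bvalsMax_eq f hu hF, Lp.ext ?_⟩
  exact ((L.maxMap_ae f hu hF).trans ht).trans (MemLp.coeFn_toLp hg).symm

lemma rep_equation (f : L.maxDomain) : ∀ᵐ x ∂(volume.restrict (Ioo L.a L.b)),
    -deriv (L.rep f).2 x + (L.q x : ℂ) * (L.rep f).1 x = (L.r x : ℂ) * L.maxMap f x := by
  filter_upwards [L.ae_of_ae_mu (L.maxMap_ae f (L.rep_mem f) (L.rep_ae f)), L.r_pos] with x hx hr
  have : (L.r x : ℂ) ≠ 0 := by exact_mod_cast hr.ne'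
  rw [hx, tau]
  field_simp

/-- `(H_max - w) f = g` is solvable with prescribed values of `f` and `f^[1]` at `a`. -/
theorem exists_maxMap_sub_smul_eq (w : ℂ) (g : L.Space) (η : Fin 2 → ℂ) :
    ∃ f : L.maxDomain, (L.bvalsMax f).1 = η ∧ L.maxMap f - w • (f : L.Space) = g := by
  have hgi : Integrable g L.μ := (Lp.memLp g).integrable one_le_two
  obtain ⟨u, hu, hη, he⟩ := L.exists_initial_value_problem w (L.integrableOn_weight_mul hgi) η
  have hm : MemLp (fun x => w * u.1 x + g x) 2 L.μ :=
    ((L.pairs_memLp hu).const_mul w).add (Lp.memLp g)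
  obtain ⟨f, hf, hb, hτ⟩ := L.exists_maxDomain_of_pair hu hm (by
    filter_upwards [he] with x hx
    rw [hx]
    ring)
  refine ⟨f, by rw [hb, hη], ?_⟩
  rw [hτ, sub_eq_iff_eq_add]
  refine Lp.ext ?_
  filter_upwards [MemLp.coeFn_toLp hm, hf, Lp.coeFn_add g (w • (f : L.Space)),
    Lp.coeFn_smul w (f : L.Space)] with x h1 h2 h3 h4
  rw [h1, h3, Pi.add_apply, h4, Pi.smul_apply, h2, smul_eq_mul, add_comm]

/-- A solution of `τ u = w u` defines an element of `ker (H_max - w)`. -/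
lemma exists_maxDomain_of_isSolution {w : ℂ} {u : (ℝ → ℂ) × (ℝ → ℂ)} (hu : L.IsSolution w u) :
    ∃ f : L.maxDomain, (f : L.Space) =ᵐ[L.μ] u.1 ∧ L.bvalsMax f = L.bvals u ∧
      L.maxMap f = w • (f : L.Space) := by
  have hm : MemLp (fun x => w * u.1 x) 2 L.μ := (L.pairs_memLp hu.1).const_mul w
  obtain ⟨f, hf, hb, hτ⟩ := L.exists_maxDomain_of_pair hu.1 hm (by
    filter_upwards [hu.2] with x hx
    rw [hx]
    ring)
  refine ⟨f, hf, hb, hτ.trans (Lp.ext ?_)⟩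
  filter_upwards [MemLp.coeFn_toLp hm, hf, Lp.coeFn_smul w (f : L.Space)] with x h1 h2 h3
  rw [h1, h3, Pi.smul_apply, h2, smul_eq_mul]

lemma isSolution_rep {w : ℂ} {f : L.maxDomain} (hf : L.maxMap f = w • (f : L.Space)) :
    L.IsSolution w (L.rep f) := by
  refine ⟨L.rep_mem f, ?_⟩
  have h1 := Lp.coeFn_smul w (f : L.Space)
  rw [← hf] at h1
  filter_upwards [L.rep_equation f, L.ae_of_ae_mu h1, L.ae_of_ae_mu (L.rep_ae f)] with x h1 h2 h3
  rw [h1, h2, Pi.smul_apply, h3, smul_eq_mul]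
  ring

/-- Green's identity for the maximal operator. -/
theorem inner_maxMap_sub_inner_maxMap (f g : L.maxDomain) :
    ⟪L.maxMap f, (g : L.Space)⟫_ℂ - ⟪(f : L.Space), L.maxMap g⟫_ℂ =
      ⟪gammaN (L.bvalsMax f), gammaD (L.bvalsMax g)⟫_ℂ -
        ⟪gammaD (L.bvalsMax f), gammaN (L.bvalsMax g)⟫_ℂ := by
  obtain ⟨v, hv⟩ : ∃ v, v = L.rep f := ⟨_, rfl⟩
  obtain ⟨u, hu⟩ : ∃ u, u = L.rep g := ⟨_, rfl⟩
  have eqf := L.rep_equation f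
  have eqg := L.rep_equation g
  have aef := L.ae_of_ae_mu (L.rep_ae f)
  have aeg := L.ae_of_ae_mu (L.rep_ae g)
  rw [← hv] at eqf aef
  rw [← hu] at eqg aeg
  rw [show L.bvalsMax f = L.bvals v from hv ▸ rfl, show L.bvalsMax g = L.bvals u from hu ▸ rfl]
  replace hv : v ∈ L.pairs := hv ▸ L.rep_mem f
  replace hu : u ∈ L.pairs := hu ▸ L.rep_mem g
  have i1 := L2.integrable_inner (𝕜 := ℂ) (L.maxMap f) (g : L.Space)
  have i2 := L2.integrable_inner (𝕜 := ℂ) (f : L.Space) (L.maxMap g)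
  rw [L2.inner_def, L2.inner_def, ← integral_sub i1 i2, L.integral_mu]
  have hi := L.integrableOn_weight_mul (i1.sub i2)
  -- The Wronskian v̄u^[1] − v̄^[1]u: in its derivative the p-terms and q-terms cancel because p and
  -- q are real, leaving the integrand. The sign at b in γ_N turns its endpoint difference into the
  -- stated inner products.
  have hac : AbsolutelyContinuousOnInterval
      (fun x => star (v.1 x) * u.2 x - star (v.2 x) * u.1 x) L.a L.b := by
    have s1 : AbsolutelyContinuousOnInterval (fun x => star (v.1 x)) L.a L.b :=
      hv.1.of_dist_le fun x _ y _ => by rw [dist_eq_norm, ← star_sub, norm_star, dist_eq_norm]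
    have s2 : AbsolutelyContinuousOnInterval (fun x => star (v.2 x)) L.a L.b :=
      hv.2.1.of_dist_le fun x _ y _ => by rw [dist_eq_norm, ← star_sub, norm_star, dist_eq_norm]
    exact (s1.fun_smul hu.2.1).fun_sub (s2.fun_smul hu.1)
  have hd : ∀ᵐ x ∂(volume.restrict (Ioo L.a L.b)),
      HasDerivAt (fun x => star (v.1 x) * u.2 x - star (v.2 x) * u.1 x)
        ((L.r x : ℂ) * (⟪L.maxMap f x, (g : L.Space) x⟫_ℂ -
          ⟪(f : L.Space) x, L.maxMap g x⟫_ℂ)) x := by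
    filter_upwards [eqf, eqg, hv.2.2, hu.2.2, aef, aeg,
      ae_restrict_of_ae hv.1.boundedVariationOn.ae_differentiableAt_of_mem_uIcc,
      ae_restrict_of_ae hv.2.1.boundedVariationOn.ae_differentiableAt_of_mem_uIcc,
      ae_restrict_of_ae hu.1.boundedVariationOn.ae_differentiableAt_of_mem_uIcc,
      ae_restrict_of_ae hu.2.1.boundedVariationOn.ae_differentiableAt_of_mem_uIcc,
      ae_restrict_mem measurableSet_Ioo] with x ef eg pf pg rf rg d1 d2 d3 d4 hx
    have hx' : x ∈ uIcc L.a L.b := Ioo_subset_Icc_self.trans Icc_subset_uIcc hx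
    refine (((d1 hx').hasDerivAt.star.fun_mul (d4 hx').hasDerivAt).fun_sub
      ((d2 hx').hasDerivAt.star.fun_mul (d3 hx').hasDerivAt)).congr_deriv ?_
    have ef' := congrArg star ef
    simp only [star_add, star_neg, star_mul', RCLike.star_def, Complex.conj_ofReal] at ef'
    simp only [RCLike.inner_apply, rf, rg, pf, pg, star_mul', RCLike.star_def,
      Complex.conj_ofReal]
    linear_combination u.1 x * ef' - (starRingEnd ℂ (v.1 x)) * eg
  have hd' : ∀ᵐ x, x ∈ uIcc L.a L.b → HasDerivAt (fun x => star (v.1 x) * u.2 x -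
      star (v.2 x) * u.1 x) ((L.r x : ℂ) * (⟪L.maxMap f x, (g : L.Space) x⟫_ℂ -
          ⟪(f : L.Space) x, L.maxMap g x⟫_ℂ)) x := by
    rwa [restrict_Ioo_eq_restrict_Icc, ae_restrict_iff' measurableSet_Icc,
      ← uIcc_of_le L.hab.le] at hd
  rw [← integral_Ioc_eq_integral_Ioo, ← intervalIntegral.integral_of_le L.hab.le]
  refine (hac.integral_eq_sub_of_ae_hasDerivAt
    ((intervalIntegrable_iff_integrableOn_Ioo_of_le L.hab.le).2 hi) hd').trans ?_
  simp only [PiLp.inner_apply, Fin.sum_univ_two, gammaN, gammaD, bvals, LinearMap.coe_mk,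
    AddHom.coe_mk, RCLike.inner_apply, RCLike.star_def]
  simp
  ring

end SturmLiouville
end

/-! ### Algebra of the boundary matrices. -/

section BoundaryMatrices

open Matrix

lemma toEuclideanLin_mul_apply (M N : Matrix (Fin 2) (Fin 2) ℂ) (x : EuclideanSpace ℂ (Fin 2)) :
    toEuclideanLin (M * N) x = toEuclideanLin M (toEuclideanLin N x) := by
  ext i
  simp [toLpLin_apply]

lemma inner_toEuclideanLin_left (M : Matrix (Fin 2) (Fin 2) ℂ) (x y : EuclideanSpace ℂ (Fin 2)) :
    ⟪toEuclideanLin M x, y⟫_ℂ = ⟪x, toEuclideanLin Mᴴ y⟫_ℂ := by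
  rw [toEuclideanLin_conjTranspose_eq_adjoint, LinearMap.adjoint_inner_right]

lemma gammaAB_eq (A B : Matrix (Fin 2) (Fin 2) ℂ) (v : (Fin 2 → ℂ) × (Fin 2 → ℂ)) :
    gammaAB A B v =
      toEuclideanLin (matD A B) (gammaD v) + toEuclideanLin (matN A B) (gammaN v) := by
  ext i
  fin_cases i <;>
  · simp [gammaAB, gammaD, gammaN, matD, matN, toLpLin_apply]
    ring

/-- Entrywise, AJA* − BJB* is exactly ND* − DN*. -/
lemma IsBoundaryPair.matD_mul_matN {A B : Matrix (Fin 2) (Fin 2) ℂ} (h : IsBoundaryPair A B) :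
    matD A B * (matN A B)ᴴ = matN A B * (matD A B)ᴴ := by
  have h2 := h.2
  ext i j
  have := congrFun (congrFun h2 i) j
  fin_cases i <;> fin_cases j <;>
  · simp [matD, matN, mul_apply, Fin.sum_univ_two] at this ⊢
    linear_combination -this

/-- `D D* + N N*`. -/
abbrev matGram (A B : Matrix (Fin 2) (Fin 2) ℂ) : Matrix (Fin 2) (Fin 2) ℂ :=
  matD A B * (matD A B)ᴴ + matN A B * (matN A B)ᴴ

lemma gammaPerp_apply (A B : Matrix (Fin 2) (Fin 2) ℂ) (v : (Fin 2 → ℂ) × (Fin 2 → ℂ)) :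
    gammaPerp A B v = -toEuclideanLin ((matGram A B)⁻¹ * matN A B) (gammaD v) +
      toEuclideanLin ((matGram A B)⁻¹ * matD A B) (gammaN v) := by
  simp only [gammaPerp, matDperp, matNperp, LinearMap.add_apply, LinearMap.comp_apply, map_neg,
    LinearMap.neg_apply]

/-- (D N) arises from (A B) by permuting columns and changing a sign, which does not affect the Gram
matrix of the rows; the rank condition then makes it invertible. -/
lemma matGram_eq (A B : Matrix (Fin 2) (Fin 2) ℂ) :
    matGram A B = fromCols A B * (fromCols A B)ᴴ := by
  rw [conjTranspose_fromCols_eq_fromRows_conjTranspose, fromCols_mul_fromRows]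
  ext i j
  fin_cases i <;> fin_cases j <;>
  · simp only [matGram, Matrix.add_apply, mul_apply, Fin.sum_univ_two, conjTranspose_apply,
      matD, matN]
    simp
    ring

open scoped ComplexOrder in
lemma IsBoundaryPair.isUnit_matGram {A B : Matrix (Fin 2) (Fin 2) ℂ} (h : IsBoundaryPair A B) :
    IsUnit (matGram A B) := by
  have hr : (matGram A B).rank = 2 := by rw [matGram_eq, rank_self_mul_conjTranspose, h.1]
  rw [← mulVec_surjective_iff_isUnit]
  change Function.Surjective (matGram A B).mulVecLin
  rw [← LinearMap.range_eq_top]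
  refine Submodule.eq_top_of_finrank_eq ?_
  rw [← rank, hr, Module.finrank_fintype_fun_eq_card, Fintype.card_fin]

section Identities

variable {D N E D' N' : Matrix (Fin 2) (Fin 2) ℂ}

/-- The square block matrix with rows (D, N) and (−EN, ED), which takes (γ_D, γ_N) to (γ, γ^⊥), has
an explicit right inverse. That is also a left inverse, and the first row of the reversed product
gives both identities. -/
lemma block_identities (hDN : D * Nᴴ = N * Dᴴ) (hE : E * (D * Dᴴ + N * Nᴴ) = 1)
    (hE' : (D * Dᴴ + N * Nᴴ) * E = 1) :
    Dᴴ * E * D + Nᴴ * E * N = 1 ∧ Dᴴ * E * N = Nᴴ * E * D := by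
  have h : fromBlocks D N (-(E * N)) (E * D) * fromBlocks (Dᴴ * E) (-Nᴴ) (Nᴴ * E) Dᴴ = 1 := by
    rw [fromBlocks_multiply, ← fromBlocks_one, fromBlocks_inj]
    refine ⟨?_, ?_, ?_, ?_⟩
    · rw [← hE']; noncomm_ring
    · rw [mul_neg, hDN, neg_add_cancel]
    · calc -(E * N) * (Dᴴ * E) + E * D * (Nᴴ * E) = E * (D * Nᴴ - N * Dᴴ) * E := by noncomm_ring
        _ = 0 := by simp [hDN]
    · rw [← hE]; noncomm_ring
  rw [mul_eq_one_comm, fromBlocks_multiply, ← fromBlocks_one, fromBlocks_inj] at h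
  obtain ⟨h1, h2, -, -⟩ := h
  constructor
  · rw [← h1]; noncomm_ring
  · rw [← sub_eq_zero, ← h2]; noncomm_ring

/-- Insert the resolution of the identity `h1` and the vanishing difference from `h2`. The
coefficients X and S expand the row (D', N') in the rows of the block matrix above. -/
lemma trace_decomposition (h1 : Dᴴ * E * D + Nᴴ * E * N = 1) (h2 : Dᴴ * E * N = Nᴴ * E * D) :
    D' = (D' * Dᴴ + N' * Nᴴ) * E * D - (N' * Dᴴ - D' * Nᴴ) * (E * N) ∧
    N' = (D' * Dᴴ + N' * Nᴴ) * E * N + (N' * Dᴴ - D' * Nᴴ) * (E * D) := by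
  constructor
  · calc D' = D' * (Dᴴ * E * D + Nᴴ * E * N) - N' * (Dᴴ * E * N - Nᴴ * E * D) := by
          rw [h1, h2]; simp
      _ = _ := by noncomm_ring
  · calc N' = N' * (Dᴴ * E * D + Nᴴ * E * N) + D' * (Dᴴ * E * N - Nᴴ * E * D) := by
          rw [h1, h2]; simp
      _ = _ := by noncomm_ring

/-- The symmetry of D'N'* expressed in the coordinates X and S, as XS* = SX*; it later forces ran
ΛS* ⊆ ran S. -/
lemma cross_symmetric (hE : Eᴴ = E) (hDN' : D' * N'ᴴ = N' * D'ᴴ)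
    (h1 : Dᴴ * E * D + Nᴴ * E * N = 1) (h2 : Dᴴ * E * N = Nᴴ * E * D) :
    (D' * Dᴴ + N' * Nᴴ) * E * (N' * Dᴴ - D' * Nᴴ)ᴴ =
      (N' * Dᴴ - D' * Nᴴ) * ((D' * Dᴴ + N' * Nᴴ) * E)ᴴ := by
  simp only [conjTranspose_mul, conjTranspose_sub, conjTranspose_add, conjTranspose_conjTranspose,
    hE]
  rw [← sub_eq_zero]
  calc _ = D' * (Dᴴ * E * D + Nᴴ * E * N) * N'ᴴ - N' * (Dᴴ * E * D + Nᴴ * E * N) * D'ᴴ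
        - D' * (Dᴴ * E * N - Nᴴ * E * D) * D'ᴴ - N' * (Dᴴ * E * N - Nᴴ * E * D) * N'ᴴ := by
        noncomm_ring
    _ = 0 := by rw [h1, h2]; simp [hDN']

end Identities

namespace IsBoundaryPair

variable {A B A' B' : Matrix (Fin 2) (Fin 2) ℂ}

lemma inv_mul_matGram (h : IsBoundaryPair A B) : (matGram A B)⁻¹ * matGram A B = 1 :=
  nonsing_inv_mul _ ((isUnit_iff_isUnit_det _).1 h.isUnit_matGram)

lemma matGram_mul_inv (h : IsBoundaryPair A B) : matGram A B * (matGram A B)⁻¹ = 1 :=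
  mul_nonsing_inv _ ((isUnit_iff_isUnit_det _).1 h.isUnit_matGram)

lemma identities (h : IsBoundaryPair A B) :
    (matD A B)ᴴ * (matGram A B)⁻¹ * matD A B + (matN A B)ᴴ * (matGram A B)⁻¹ * matN A B = 1 ∧
    (matD A B)ᴴ * (matGram A B)⁻¹ * matN A B = (matN A B)ᴴ * (matGram A B)⁻¹ * matD A B :=
  block_identities h.matD_mul_matN h.inv_mul_matGram h.matGram_mul_inv

/-- On the kernel of `γ_{A,B}` the Dirichlet and Neumann traces are determined by `γ^⊥_{A,B}`. -/
lemma gammaD_gammaN_of_gammaAB_eq_zero (h : IsBoundaryPair A B) {v : (Fin 2 → ℂ) × (Fin 2 → ℂ)}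
    (hv : gammaAB A B v = 0) :
    gammaD v = -toEuclideanLin (matN A B)ᴴ (gammaPerp A B v) ∧
      gammaN v = toEuclideanLin (matD A B)ᴴ (gammaPerp A B v) := by
  obtain ⟨h1, h2⟩ := h.identities
  rw [gammaAB_eq] at hv
  -- Multiply γv = 0 by D*E and N*E, with E the inverse Gram matrix, and subtract from the
  -- resolution of the identity applied to γ_D v and γ_N v.
  have e1 := congrArg (toEuclideanLin ((matD A B)ᴴ * (matGram A B)⁻¹)) hv
  have e2 := congrArg (toEuclideanLin ((matN A B)ᴴ * (matGram A B)⁻¹)) hv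
  have k1 := congrArg (fun M => toEuclideanLin M (gammaD v)) h1
  have k2 := congrArg (fun M => toEuclideanLin M (gammaN v)) h1
  have k3 := congrArg (fun M => toEuclideanLin M (gammaD v)) h2
  have k4 := congrArg (fun M => toEuclideanLin M (gammaN v)) h2
  have one : ∀ x, toEuclideanLin (1 : Matrix (Fin 2) (Fin 2) ℂ) x = x := fun x => by
    ext i; simp
  simp only [map_add, map_zero, LinearMap.add_apply, toEuclideanLin_mul_apply, one]
    at e1 e2 k1 k2 k3 k4
  simp only [gammaPerp_apply, toEuclideanLin_mul_apply, map_add, map_neg]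
  constructor
  · rw [← sub_eq_zero, ← e1]
    nth_rewrite 1 [← k1]
    rw [k4]
    abel
  · rw [← sub_eq_zero, ← e2]
    nth_rewrite 1 [← k2]
    rw [k3]
    abel

/-- The boundary form paired with a vector in the kernel of `γ_{A,B}`. -/
lemma boundary_form_eq (h : IsBoundaryPair A B) {v : (Fin 2 → ℂ) × (Fin 2 → ℂ)}
    (hv : gammaAB A B v = 0) (u : (Fin 2 → ℂ) × (Fin 2 → ℂ)) :
    ⟪gammaN v, gammaD u⟫_ℂ - ⟪gammaD v, gammaN u⟫_ℂ = ⟪gammaPerp A B v, gammaAB A B u⟫_ℂ := by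
  obtain ⟨h1, h2⟩ := h.gammaD_gammaN_of_gammaAB_eq_zero hv
  rw [h1, h2, inner_neg_left, inner_toEuclideanLin_left, inner_toEuclideanLin_left,
    conjTranspose_conjTranspose, conjTranspose_conjTranspose, sub_neg_eq_add, ← inner_add_right,
    ← gammaAB_eq]

/-- The decomposition `γ_{A',B'} = S γ^⊥_{A,B} + X γ_{A,B}` with
`X = (D' D* + N' N*) (D D* + N N*)⁻¹`. -/
lemma exists_gammaAB_decomposition (h : IsBoundaryPair A B) (h' : IsBoundaryPair A' B') :
    ∃ X : Matrix (Fin 2) (Fin 2) ℂ, X * (matS A' B' A B)ᴴ = matS A' B' A B * Xᴴ ∧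
      ∀ v, gammaAB A' B' v = toEuclideanLin (matS A' B' A B) (gammaPerp A B v) +
        toEuclideanLin X (gammaAB A B v) := by
  obtain ⟨h1, h2⟩ := h.identities
  have hE : ((matGram A B)⁻¹)ᴴ = (matGram A B)⁻¹ := by
    rw [conjTranspose_nonsing_inv, matGram_eq, conjTranspose_mul, conjTranspose_conjTranspose]
  obtain ⟨d1, d2⟩ := trace_decomposition (D' := matD A' B') (N' := matN A' B') h1 h2
  refine ⟨(matD A' B' * (matD A B)ᴴ + matN A' B' * (matN A B)ᴴ) * (matGram A B)⁻¹,
    cross_symmetric hE h'.matD_mul_matN h1 h2, fun v => ?_⟩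
  rw [gammaAB_eq, gammaAB_eq]
  refine (congrArg₂ (· + ·) (congrArg (fun M => toEuclideanLin M (gammaD v)) d1)
    (congrArg (fun M => toEuclideanLin M (gammaN v)) d2)).trans ?_
  change _ = toEuclideanLin (matN A' B' * (matD A B)ᴴ - matD A' B' * (matN A B)ᴴ) _ + _
  generalize matN A' B' * (matD A B)ᴴ - matD A' B' * (matN A B)ᴴ = S
  generalize (matD A' B' * (matD A B)ᴴ + matN A' B' * (matN A B)ᴴ) * (matGram A B)⁻¹ = X
  rw [gammaPerp_apply]
  simp only [toEuclideanLin_mul_apply, map_add, map_sub, LinearMap.add_apply, LinearMap.sub_apply,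
    map_neg]
  abel

end IsBoundaryPair

end BoundaryMatrices

/-! ### Self-adjointness, the boundary value problem and the resolvent set. -/

noncomputable section

section Unbounded

variable {E : Type*} [NormedAddCommGroup E] [InnerProductSpace ℂ E] [CompleteSpace E]

/-- A symmetric operator `T` such that `T - z` and `T - z̄` are surjective is self-adjoint. -/
theorem isSelfAdjoint_of_surjective {T : E →ₗ.[ℂ] E} (hT : T.IsFormalAdjoint T) {z : ℂ}
    (hz : ∀ g, ∃ f : T.domain, T f - z • (f : E) = g)
    (hz' : ∀ g, ∃ f : T.domain, T f - (starRingEnd ℂ z) • (f : E) = g) : IsSelfAdjoint T := by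
  have hsub : ∀ x y : T.domain, ⟪T x - z • (x : E), (y : E)⟫_ℂ =
      ⟪(x : E), T y - (starRingEnd ℂ z) • (y : E)⟫_ℂ := fun x y => by
    rw [inner_sub_left, inner_sub_right, inner_smul_left, inner_smul_right, hT x y]
  have hdense : Dense (T.domain : Set E) := by
    rw [Submodule.dense_iff_topologicalClosure_eq_top, Submodule.topologicalClosure_eq_top_iff,
      Submodule.eq_bot_iff]
    -- For k ⟂ dom T write k = (T − z)x and x = (T − z̄)f; then ⟨x, x⟩ = ⟨k, f⟩ = 0.
    intro k hk
    obtain ⟨x, rfl⟩ := hz k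
    obtain ⟨f, hf⟩ := hz' (x : E)
    have h1 : (x : E) = 0 := by
      rw [← inner_self_eq_zero (𝕜 := ℂ)]
      nth_rewrite 2 [← hf]
      rw [← hsub, Submodule.inner_left_of_mem_orthogonal f.2 hk]
    have h2 : x = 0 := Subtype.ext h1
    rw [h2, LinearPMap.map_zero, Submodule.coe_zero, smul_zero, sub_zero]
  rw [LinearPMap.isSelfAdjoint_def]
  have hle : T ≤ T.adjoint := hT.le_adjoint hdense
  refine (LinearPMap.eq_of_le_of_domain_eq hle (le_antisymm hle.1 fun y hy => ?_)).symm
  have hadj := LinearPMap.adjoint_isFormalAdjoint hdense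
  -- Choose x in dom T with (T − z)x = (T* − z)y; then y − x is orthogonal to ran(T − z̄), which is
  -- everything.
  obtain ⟨x, hx⟩ := hz (T.adjoint ⟨y, hy⟩ - z • y)
  suffices h : y = x from h ▸ x.2
  rw [← sub_eq_zero, ← inner_self_eq_zero (𝕜 := ℂ)]
  obtain ⟨f, hf⟩ := hz' (y - x)
  nth_rewrite 2 [← hf]
  have h1 := hsub x f
  have h2 : ⟪T.adjoint ⟨y, hy⟩ - z • y, (f : E)⟫_ℂ =
      ⟪y, T f - (starRingEnd ℂ z) • (f : E)⟫_ℂ := by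
    rw [inner_sub_left, inner_sub_right, inner_smul_left, inner_smul_right, hadj ⟨y, hy⟩ f]
  rw [inner_sub_left, ← h1, ← h2, hx, sub_self]

end Unbounded

lemma pmapResolvent_spec {E : Type*} [NormedAddCommGroup E] [NormedSpace ℂ E] {T : E →ₗ.[ℂ] E}
    {z : ℂ} (h : z ∈ pmapResolventSet T) : IsResolventAt T z (pmapResolvent T z) := by
  have h' : ∃ R : E →L[ℂ] E, IsResolventAt T z R := h
  rw [pmapResolvent, dif_pos h']
  exact h'.choose_spec

namespace SturmLiouville

variable (L : SturmLiouville) (A B : Matrix (Fin 2) (Fin 2) ℂ)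

lemma mem_H_domain {x : L.Space} : x ∈ (L.H A B).domain ↔
    ∃ f : L.maxDomain, (f : L.Space) = x ∧ gammaAB A B (L.bvalsMax f) = 0 := by
  constructor
  · rintro ⟨⟨f, hf, rfl⟩, -⟩
    exact ⟨f, rfl, hf⟩
  · rintro ⟨f, rfl, hf⟩
    exact ⟨⟨f, hf, rfl⟩, f.2⟩

lemma H_apply {f : L.maxDomain} (h : (f : L.Space) ∈ (L.H A B).domain) :
    L.H A B ⟨f, h⟩ = L.maxMap f :=
  LinearPMap.domRestrict_apply rfl

lemma Hmin_le_H : L.Hmin ≤ L.H A B := by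
  refine ⟨inf_le_inf_right _ (Submodule.map_mono fun f hf => ?_), fun x y hxy => ?_⟩
  · rw [LinearMap.mem_ker] at hf ⊢
    rw [LinearMap.comp_apply, hf, map_zero]
  · exact (LinearPMap.domRestrict_apply (x := x) (y := ⟨x, x.2.2⟩) rfl).trans
      (LinearPMap.domRestrict_apply (x := y) (y := ⟨x, x.2.2⟩) hxy.symm).symm

/-- `u` solves `(H_max - w) u = 0`. -/
def solutionSpace (w : ℂ) : Submodule ℂ L.maxDomain :=
  LinearMap.ker (L.maxMap - w • L.maxDomain.subtype)

lemma mem_solutionSpace {w : ℂ} {f : L.maxDomain} :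
    f ∈ L.solutionSpace w ↔ L.maxMap f = w • (f : L.Space) := by
  rw [solutionSpace, LinearMap.mem_ker, LinearMap.sub_apply, LinearMap.smul_apply,
    Submodule.subtype_apply, sub_eq_zero]

/-- `w` is not an eigenvalue of `H_{A,B}`. -/
def NotEigenvalue (w : ℂ) : Prop :=
  ∀ f ∈ L.solutionSpace w, gammaAB A B (L.bvalsMax f) = 0 → f = 0

variable {A B} {L}

/-- If `w` is not an eigenvalue then the boundary value problem is uniquely solvable. -/
theorem NotEigenvalue.bijective {w : ℂ} (h : L.NotEigenvalue A B w) :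
    Function.Bijective ((gammaAB A B ∘ₗ L.bvalsMax) ∘ₗ (L.solutionSpace w).subtype) := by
  have hinj : Function.Injective
      ((gammaAB A B ∘ₗ L.bvalsMax) ∘ₗ (L.solutionSpace w).subtype) := by
    rw [← LinearMap.ker_eq_bot, LinearMap.ker_eq_bot']
    exact fun f hf => Subtype.ext (h f f.2 hf)
  have hfin : FiniteDimensional ℂ (L.solutionSpace w) := Module.Finite.of_injective _ hinj
  -- Arbitrary Cauchy data at a are attained, so the solution space has dimension at least 2;
  -- injectivity into ℂ² gives at most 2. Uniqueness for the initial value problem is not needed.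
  have hsurj : Function.Surjective
      ((LinearMap.fst ℂ (Fin 2 → ℂ) (Fin 2 → ℂ) ∘ₗ L.bvalsMax) ∘ₗ
        (L.solutionSpace w).subtype) := fun η => by
    obtain ⟨f, hf, he⟩ := L.exists_maxMap_sub_smul_eq w 0 η
    exact ⟨⟨f, L.mem_solutionSpace.2 (sub_eq_zero.1 he)⟩, hf⟩
  have h1 := LinearMap.finrank_le_finrank_of_injective hinj
  have h2 := LinearMap.finrank_range_of_inj hinj
  have h3 := LinearMap.finrank_range_le ((LinearMap.fst ℂ (Fin 2 → ℂ) (Fin 2 → ℂ) ∘ₗ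
    L.bvalsMax) ∘ₗ (L.solutionSpace w).subtype)
  rw [LinearMap.range_eq_top.2 hsurj, finrank_top] at h3
  rw [Module.finrank_fintype_fun_eq_card, Fintype.card_fin] at h3
  rw [finrank_euclideanSpace, Fintype.card_fin] at h1
  refine ⟨hinj, LinearMap.range_eq_top.1 (Submodule.eq_top_of_finrank_eq ?_)⟩
  rw [h2, finrank_euclideanSpace, Fintype.card_fin]
  exact le_antisymm h1 h3

/-- The solution operator `c ↦ u_{A,B}(w, · ; c)` of the boundary value problem. -/
lemma NotEigenvalue.exists_solutionMap {w : ℂ} (h : L.NotEigenvalue A B w) :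
    ∃ K : EuclideanSpace ℂ (Fin 2) →ₗ[ℂ] L.maxDomain, (∀ c, L.maxMap (K c) = w • (K c : L.Space)) ∧
      ∀ c, gammaAB A B (L.bvalsMax (K c)) = c := by
  let e := LinearEquiv.ofBijective _ h.bijective
  refine ⟨(L.solutionSpace w).subtype ∘ₗ e.symm.toLinearMap,
    fun c => L.mem_solutionSpace.1 (e.symm c).2, fun c => ?_⟩
  exact LinearEquiv.apply_symm_apply e c

/-- A particular solution is corrected by the homogeneous one with the same γ_{A,B}. -/
lemma NotEigenvalue.exists_eq {w : ℂ} (h : L.NotEigenvalue A B w) (g : L.Space) :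
    ∃ f : L.maxDomain, gammaAB A B (L.bvalsMax f) = 0 ∧ L.maxMap f - w • (f : L.Space) = g := by
  obtain ⟨K, hK, hγ⟩ := h.exists_solutionMap
  obtain ⟨f, -, hf⟩ := L.exists_maxMap_sub_smul_eq w g 0
  refine ⟨f - K (gammaAB A B (L.bvalsMax f)), ?_, ?_⟩
  · rw [map_sub, map_sub, hγ, sub_self]
  · rw [map_sub, hK, Submodule.coe_sub, smul_sub, sub_sub_sub_cancel_right, hf]

lemma NotEigenvalue.ext {w : ℂ} (h : L.NotEigenvalue A B w) {f g : L.maxDomain}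
    (hf : L.maxMap f = w • (f : L.Space)) (hg : L.maxMap g = w • (g : L.Space))
    (hfg : gammaAB A B (L.bvalsMax f) = gammaAB A B (L.bvalsMax g)) : f = g := by
  rw [← sub_eq_zero]
  refine h _ ((L.solutionSpace w).sub_mem (L.mem_solutionSpace.2 hf) (L.mem_solutionSpace.2 hg)) ?_
  rw [map_sub, map_sub, hfg, sub_self]

section Resolvent

variable {w : ℂ}

lemma exists_resolvent (hw : w ∈ pmapResolventSet (L.H A B)) (g : L.Space) :
    ∃ f : L.maxDomain,
    (f : L.Space) = pmapResolvent (L.H A B) w g ∧ gammaAB A B (L.bvalsMax f) = 0 ∧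
      L.maxMap f - w • (f : L.Space) = g := by
  obtain ⟨h, he⟩ := (pmapResolvent_spec hw).1 g
  obtain ⟨f, hf, hγ⟩ := (L.mem_H_domain A B).1 h
  refine ⟨f, hf, hγ, ?_⟩
  have h' : (f : L.Space) ∈ (L.H A B).domain := hf ▸ h
  rw [← he, ← L.H_apply A B h']
  congr 1
  · congr 1
    exact Subtype.ext hf
  · rw [hf]

lemma resolvent_apply (hw : w ∈ pmapResolventSet (L.H A B))
    {f : L.maxDomain} (hf : gammaAB A B (L.bvalsMax f) = 0) :
    pmapResolvent (L.H A B) w (L.maxMap f - w • (f : L.Space)) = f := by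
  have h : (f : L.Space) ∈ (L.H A B).domain := (L.mem_H_domain A B).2 ⟨f, rfl, hf⟩
  have := (pmapResolvent_spec hw).2 ⟨f, h⟩
  rwa [L.H_apply A B h] at this

lemma notEigenvalue_of_mem (hw : w ∈ pmapResolventSet (L.H A B)) :
    L.NotEigenvalue A B w := fun f hf hγ => by
  have := resolvent_apply hw hγ
  rw [L.mem_solutionSpace.1 hf, sub_self, map_zero] at this
  exact Subtype.ext this.symm

end Resolvent

variable (L)

/-- The boundary term in Green's identity is ⟨γ^⊥f, γg⟩, and γg = 0. -/
lemma inner_maxMap_symm (h : IsBoundaryPair A B) {f g : L.maxDomain}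
    (hf : gammaAB A B (L.bvalsMax f) = 0) (hg : gammaAB A B (L.bvalsMax g) = 0) :
    ⟪L.maxMap f, (g : L.Space)⟫_ℂ = ⟪(f : L.Space), L.maxMap g⟫_ℂ := by
  rw [← sub_eq_zero, L.inner_maxMap_sub_inner_maxMap, h.boundary_form_eq hf, hg, inner_zero_right]

lemma isFormalAdjoint_H (h : IsBoundaryPair A B) : (L.H A B).IsFormalAdjoint (L.H A B) := by
  rintro ⟨x, hx⟩ ⟨y, hy⟩
  obtain ⟨f, rfl, hf⟩ := (L.mem_H_domain A B).1 hx
  obtain ⟨g, rfl, hg⟩ := (L.mem_H_domain A B).1 hy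
  rw [L.H_apply, L.H_apply]
  exact L.inner_maxMap_symm h hf hg

/-- `|Im w| ‖f‖ ≤ ‖(H_{A,B} - w) f‖`. -/
lemma abs_im_mul_norm_le (h : IsBoundaryPair A B) (w : ℂ) {f : L.maxDomain}
    (hf : gammaAB A B (L.bvalsMax f) = 0) :
    |w.im| * ‖(f : L.Space)‖ ≤ ‖L.maxMap f - w • (f : L.Space)‖ := by
  have hs := L.inner_maxMap_symm h hf hf
  have him : (⟪(f : L.Space), L.maxMap f⟫_ℂ).im = 0 := by
    rw [← Complex.conj_eq_iff_im, inner_conj_symm, hs]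
  -- Since ⟨f, H_max f⟩ is real, only the shift by w contributes to the imaginary part.
  have h1 : (⟪(f : L.Space), L.maxMap f - w • (f : L.Space)⟫_ℂ).im =
      -(w.im * ‖(f : L.Space)‖ ^ 2) := by
    rw [inner_sub_right, inner_smul_right, inner_self_eq_norm_sq_to_K, Complex.sub_im, him,
      zero_sub]
    congr 1
    change (w * ((‖(f : L.Space)‖ : ℂ) ^ 2)).im = _
    rw [← Complex.ofReal_pow, Complex.im_mul_ofReal]
  have h2 : |w.im| * ‖(f : L.Space)‖ ^ 2 ≤
      ‖(f : L.Space)‖ * ‖L.maxMap f - w • (f : L.Space)‖ := by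
    calc |w.im| * ‖(f : L.Space)‖ ^ 2 = |-(w.im * ‖(f : L.Space)‖ ^ 2)| := by
          rw [abs_neg, abs_mul, abs_of_nonneg (sq_nonneg ‖(f : L.Space)‖)]
      _ ≤ _ := by
          rw [← h1]
          exact (Complex.abs_im_le_norm _).trans (norm_inner_le_norm _ _)
  rcases (norm_nonneg (f : L.Space)).eq_or_lt with h0 | h0
  · rw [← h0, mul_zero]
    exact norm_nonneg _
  · refine le_of_mul_le_mul_left ?_ h0
    calc _ = |w.im| * ‖(f : L.Space)‖ ^ 2 := by ring
      _ ≤ _ := h2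

/-- Nonreal numbers belong to the resolvent set of `H_{A,B}`. -/
theorem mem_resolventSet_of_im_ne_zero (h : IsBoundaryPair A B) {w : ℂ} (hw : w.im ≠ 0) :
    w ∈ pmapResolventSet (L.H A B) := by
  have hpos : 0 < |w.im| := abs_pos.2 hw
  have hne : L.NotEigenvalue A B w := fun f hf hγ => by
    have := L.abs_im_mul_norm_le h w hγ
    rw [L.mem_solutionSpace.1 hf, sub_self, norm_zero] at this
    exact Subtype.ext (norm_le_zero_iff.1 (nonpos_of_mul_nonpos_right this hpos))
  let V : Submodule ℂ L.maxDomain := LinearMap.ker (gammaAB A B ∘ₗ L.bvalsMax)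
  let T : V →ₗ[ℂ] L.Space := (L.maxMap - w • L.maxDomain.subtype) ∘ₗ V.subtype
  have hT : Function.Bijective T := by
    constructor
    · rw [← LinearMap.ker_eq_bot, LinearMap.ker_eq_bot']
      exact fun f hf => Subtype.ext (hne f hf f.2)
    · intro g
      obtain ⟨f, hf, hg⟩ := hne.exists_eq g
      exact ⟨⟨f, hf⟩, hg⟩
  let e := LinearEquiv.ofBijective T hT
  let R : L.Space →L[ℂ] L.Space :=
    (L.maxDomain.subtype ∘ₗ V.subtype ∘ₗ e.symm.toLinearMap).mkContinuous |w.im|⁻¹ fun g => by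
      rw [inv_mul_eq_div, le_div_iff₀' hpos]
      have h1 : T (e.symm g) = g := LinearEquiv.apply_symm_apply e g
      exact (L.abs_im_mul_norm_le h w (e.symm g).2).trans_eq (congrArg norm h1)
  refine ⟨R, fun g => ?_, ?_⟩
  · have h1 : T (e.symm g) = g := LinearEquiv.apply_symm_apply e g
    refine ⟨(L.mem_H_domain A B).2 ⟨(e.symm g).1, rfl, (e.symm g).2⟩, ?_⟩
    refine Eq.trans ?_ h1
    exact congrArg (· - w • ((e.symm g).1 : L.Space)) (L.H_apply A B _)
  · rintro ⟨x, hx⟩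
    obtain ⟨f, rfl, hf⟩ := (L.mem_H_domain A B).1 hx
    rw [L.H_apply]
    have h1 : e.symm (T ⟨f, hf⟩) = ⟨f, hf⟩ := LinearEquiv.symm_apply_apply e _
    exact congrArg (fun v : V => ((v : L.maxDomain) : L.Space)) h1

/-- A real z is its own conjugate, and all nonreal numbers are in the resolvent set. -/
lemma conj_mem_resolventSet (h : IsBoundaryPair A B) {z : ℂ}
    (hz : z ∈ pmapResolventSet (L.H A B)) :
    starRingEnd ℂ z ∈ pmapResolventSet (L.H A B) := by
  by_cases hi : z.im = 0
  · rwa [Complex.conj_eq_iff_im.2 hi]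
  · exact L.mem_resolventSet_of_im_ne_zero h (by simpa using hi)

theorem isSelfAdjoint_H (h : IsBoundaryPair A B) {z : ℂ}
    (hz : z ∈ pmapResolventSet (L.H A B)) : IsSelfAdjoint (L.H A B) := by
  have key : ∀ w ∈ pmapResolventSet (L.H A B),
      ∀ g, ∃ f : (L.H A B).domain, L.H A B f - w • (f : L.Space) = g := fun w hw g =>
    ⟨⟨_, ((pmapResolvent_spec hw).1 g).1⟩, ((pmapResolvent_spec hw).1 g).2⟩
  exact isSelfAdjoint_of_surjective (L.isFormalAdjoint_H h) (key z hz)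
    (key _ (L.conj_mem_resolventSet h hz))

end SturmLiouville
end

/-! ### Trace resolvents, the boundary data map and Krein's formula. -/

noncomputable section

namespace SturmLiouville

open Matrix

variable {L : SturmLiouville} {A B A' B' : Matrix (Fin 2) (Fin 2) ℂ}

lemma IsTraceResolvent.unique {γ : (Fin 2 → ℂ) × (Fin 2 → ℂ) →ₗ[ℂ] EuclideanSpace ℂ (Fin 2)}
    {w : ℂ} {G G' : L.Space →L[ℂ] EuclideanSpace ℂ (Fin 2)}
    (h : L.IsTraceResolvent γ A B w G) (h' : L.IsTraceResolvent γ A B w G') : G = G' := by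
  ext1 f
  obtain ⟨_, h1⟩ := h f
  obtain ⟨_, h2⟩ := h' f
  rw [h1, h2]

lemma IsTraceResolvent.traceResolvent
    {γ : (Fin 2 → ℂ) × (Fin 2 → ℂ) →ₗ[ℂ] EuclideanSpace ℂ (Fin 2)}
    {w : ℂ} {G : L.Space →L[ℂ] EuclideanSpace ℂ (Fin 2)} (h : L.IsTraceResolvent γ A B w G) :
    L.IsTraceResolvent γ A B w (L.traceResolvent γ A B w) := by
  have h' : ∃ G, L.IsTraceResolvent γ A B w G := ⟨G, h⟩
  rw [SturmLiouville.traceResolvent, dif_pos h']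
  exact h'.choose_spec

lemma IsTraceResolvent.eq {γ : (Fin 2 → ℂ) × (Fin 2 → ℂ) →ₗ[ℂ] EuclideanSpace ℂ (Fin 2)}
    {w : ℂ} {G : L.Space →L[ℂ] EuclideanSpace ℂ (Fin 2)} (h : L.IsTraceResolvent γ A B w G) :
    L.traceResolvent γ A B w = G :=
  h.traceResolvent.unique h

variable (L A B) in
/-- `K` maps `c` to the solution of `(H_max - w) u = 0`, `γ_{A,B} u = c`. -/
def IsSolutionMap (w : ℂ) (K : EuclideanSpace ℂ (Fin 2) →ₗ[ℂ] L.maxDomain) : Prop :=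
  (∀ c, L.maxMap (K c) = w • (K c : L.Space)) ∧ ∀ c, gammaAB A B (L.bvalsMax (K c)) = c

/-- A map into the maximal domain as a bounded operator from `ℂ²` to `L²`. -/
def toSpaceCLM (K : EuclideanSpace ℂ (Fin 2) →ₗ[ℂ] L.maxDomain) :
    EuclideanSpace ℂ (Fin 2) →L[ℂ] L.Space :=
  LinearMap.toContinuousLinearMap (L.maxDomain.subtype ∘ₗ K)

lemma toSpaceCLM_apply (K : EuclideanSpace ℂ (Fin 2) →ₗ[ℂ] L.maxDomain)
    (c : EuclideanSpace ℂ (Fin 2)) : toSpaceCLM K c = (K c : L.Space) := rfl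

/-- Pair Green's identity for v with u = K c: the boundary form collapses to ⟨γ^⊥v, c⟩. Applied to v
in the range of (H_{A,B} − w̄)⁻¹, this identifies γ^⊥(H_{A,B} − w̄)⁻¹ with K*. -/
lemma IsSolutionMap.gammaPerp_eq (h : IsBoundaryPair A B) {w : ℂ}
    {K : EuclideanSpace ℂ (Fin 2) →ₗ[ℂ] L.maxDomain} (hK : L.IsSolutionMap A B w K)
    {v : L.maxDomain} (hv : gammaAB A B (L.bvalsMax v) = 0) :
    gammaPerp A B (L.bvalsMax v) = ContinuousLinearMap.adjoint (toSpaceCLM K)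
      (L.maxMap v - (starRingEnd ℂ w) • (v : L.Space)) := by
  refine ext_inner_right ℂ fun c => ?_
  rw [ContinuousLinearMap.adjoint_inner_left, toSpaceCLM_apply, inner_sub_left, inner_smul_left,
    Complex.conj_conj, ← inner_smul_right, ← hK.1, L.inner_maxMap_sub_inner_maxMap,
    h.boundary_form_eq hv, hK.2]

lemma IsSolutionMap.isTraceResolvent (h : IsBoundaryPair A B) {w : ℂ}
    (hw : starRingEnd ℂ w ∈ pmapResolventSet (L.H A B))
    {K : EuclideanSpace ℂ (Fin 2) →ₗ[ℂ] L.maxDomain} (hK : L.IsSolutionMap A B w K) :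
    L.IsTraceResolvent (gammaPerp A B) A B (starRingEnd ℂ w)
      (ContinuousLinearMap.adjoint (toSpaceCLM K)) := fun f => by
  obtain ⟨v, hv, hγ, he⟩ := exists_resolvent hw f
  refine ⟨hv ▸ v.2, ?_⟩
  rw [← congrArg (ContinuousLinearMap.adjoint (toSpaceCLM K)) he, ← hK.gammaPerp_eq h hγ]
  congr 2
  exact Subtype.ext hv

/-- In γ' = Sγ^⊥ + Xγ the last term vanishes on dom H_{A,B}. -/
lemma IsTraceResolvent.gammaAB (h : IsBoundaryPair A B) (h' : IsBoundaryPair A' B') {w : ℂ}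
    (hw : w ∈ pmapResolventSet (L.H A B)) {G : L.Space →L[ℂ] EuclideanSpace ℂ (Fin 2)}
    (hG : L.IsTraceResolvent (gammaPerp A B) A B w G) :
    L.IsTraceResolvent (gammaAB A' B') A B w
      (toEuclideanCLM (𝕜 := ℂ) (matS A' B' A B) ∘L G) := fun f => by
  obtain ⟨v, hv, hγ, he⟩ := exists_resolvent hw f
  obtain ⟨hm, hG'⟩ := hG f
  obtain ⟨X, -, hX⟩ := h.exists_gammaAB_decomposition h'
  refine ⟨hm, ?_⟩
  have hvm : v = ⟨pmapResolvent (L.H A B) w f, hm⟩ := Subtype.ext hv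
  rw [← hvm] at hG' ⊢
  rw [hX, hγ, map_zero, add_zero, ContinuousLinearMap.comp_apply, hG']
  rfl

/-- A solution has the boundary values of the solution with the same `γ_{A,B}`. -/
lemma IsSolutionMap.gammaAB_bvals {w : ℂ} (hne : L.NotEigenvalue A B w)
    {K : EuclideanSpace ℂ (Fin 2) →ₗ[ℂ] L.maxDomain} (hK : L.IsSolutionMap A B w K)
    {u : (ℝ → ℂ) × (ℝ → ℂ)} (hu : L.IsSolution w u) :
    L.bvals u = L.bvalsMax (K (gammaAB A B (L.bvals u))) := by
  obtain ⟨f, -, hb, hf⟩ := L.exists_maxDomain_of_isSolution hu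
  rw [← hb]
  exact congrArg L.bvalsMax (hne.ext hf (hK.1 _) (hK.2 _).symm)

lemma IsSolutionMap.exists_isSolution {w : ℂ}
    {K : EuclideanSpace ℂ (Fin 2) →ₗ[ℂ] L.maxDomain} (hK : L.IsSolutionMap A B w K)
    (c : EuclideanSpace ℂ (Fin 2)) :
    ∃ u, L.IsSolution w u ∧ _root_.gammaAB A B (L.bvals u) = c :=
  ⟨L.rep (K c), L.isSolution_rep (hK.1 c), hK.2 c⟩

/-- The columns of `bdm` use arbitrarily chosen solutions, but boundary values depend only on
γ_{A,B}u, so it suffices to compare with γ'K on the standard basis. -/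
lemma IsSolutionMap.bdm_apply {w : ℂ} (hne : L.NotEigenvalue A B w)
    {K : EuclideanSpace ℂ (Fin 2) →ₗ[ℂ] L.maxDomain} (hK : L.IsSolutionMap A B w K)
    (c : EuclideanSpace ℂ (Fin 2)) :
    toEuclideanLin (L.bdm A B A' B' w) c = _root_.gammaAB A' B' (L.bvalsMax (K c)) := by
  suffices h : toEuclideanLin (L.bdm A B A' B' w) = _root_.gammaAB A' B' ∘ₗ L.bvalsMax ∘ₗ K by
    rw [h]; rfl
  refine (EuclideanSpace.basisFun (Fin 2) ℂ).toBasis.ext fun j => ?_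
  have hs := Classical.epsilon_spec (hK.exists_isSolution (EuclideanSpace.single j 1))
  have hb := hK.gammaAB_bvals hne hs.1
  rw [hs.2] at hb
  ext i
  simp only [OrthonormalBasis.coe_toBasis, EuclideanSpace.basisFun_apply, LinearMap.comp_apply]
  rw [← hb]
  simp [bdm, bvpSol]

theorem IsSolutionMap.isBoundaryDataMap {w : ℂ} (hne : L.NotEigenvalue A B w)
    {K : EuclideanSpace ℂ (Fin 2) →ₗ[ℂ] L.maxDomain} (hK : L.IsSolutionMap A B w K) :
    L.IsBoundaryDataMap A B A' B' w (L.bdm A B A' B' w) := by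
  refine ⟨hK.exists_isSolution, fun u v hu hv huv => ?_, fun u hu => ?_⟩
  · obtain ⟨f, hf, hfb, hfe⟩ := L.exists_maxDomain_of_isSolution hu
    obtain ⟨g, hg, hgb, hge⟩ := L.exists_maxDomain_of_isSolution hv
    have hfg : f = g := hne.ext hfe hge (by rw [hfb, hgb, huv])
    rw [← hfg] at hg
    have := (L.pair_eq_zero (L.pairs.sub_mem hu.1 hv.1) (by
      filter_upwards [hf, hg] with x h1 h2
      rw [Prod.fst_sub, Pi.sub_apply, ← h1, ← h2, sub_self])).1
    intro x hx
    exact sub_eq_zero.1 (this hx)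
  · rw [hK.bdm_apply hne, ← hK.gammaAB_bvals hne hu]

/-- If Λc = 0, then Kc lies in ker(H_{A',B'} − w), so Kc = 0 and c = γKc = 0. -/
theorem IsSolutionMap.isUnit_bdm {w : ℂ} (hne : L.NotEigenvalue A B w)
    (hne' : L.NotEigenvalue A' B' w)
    {K : EuclideanSpace ℂ (Fin 2) →ₗ[ℂ] L.maxDomain} (hK : L.IsSolutionMap A B w K) :
    IsUnit (L.bdm A B A' B' w) := by
  rw [← mulVec_injective_iff_isUnit]
  change Function.Injective (L.bdm A B A' B' w).mulVecLin
  rw [← LinearMap.ker_eq_bot, LinearMap.ker_eq_bot']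
  intro c hc
  have h1 := hK.bdm_apply (A' := A') (B' := B') hne (WithLp.toLp 2 c)
  have h2 : toEuclideanLin (L.bdm A B A' B' w) (WithLp.toLp 2 c) = 0 := by
    rw [toLpLin_apply]
    exact congrArg (WithLp.toLp 2) hc
  rw [h2] at h1
  have h3 := hne' _ (L.mem_solutionSpace.2 (hK.1 (WithLp.toLp 2 c))) h1.symm
  have h4 := hK.2 (WithLp.toLp 2 c)
  rw [h3, map_zero, map_zero] at h4
  exact (congrArg WithLp.ofLp h4).symm

/-- The range of `Λ(z) S*` is contained in the range of `S`. -/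
lemma IsSolutionMap.bdm_mul_mem_matRan (h : IsBoundaryPair A B) (h' : IsBoundaryPair A' B') {w : ℂ}
    (hne : L.NotEigenvalue A B w)
    {K : EuclideanSpace ℂ (Fin 2) →ₗ[ℂ] L.maxDomain} (hK : L.IsSolutionMap A B w K)
    (y : EuclideanSpace ℂ (Fin 2)) :
    toEuclideanLin (L.bdm A B A' B' w * (matS A' B' A B)ᴴ) y ∈ matRan (matS A' B' A B) := by
  obtain ⟨X, hXS, hX⟩ := h.exists_gammaAB_decomposition h'
  -- ΛS*y = γ'KS*y = Sγ^⊥KS*y + XS*y, and XS* = SX*.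
  rw [toEuclideanLin_mul_apply, hK.bdm_apply hne, hX, hK.2, ← toEuclideanLin_mul_apply, hXS,
    toEuclideanLin_mul_apply, ← map_add]
  exact LinearMap.mem_range_self _ _

/-- Krein's formula before the boundary terms are expressed by trace resolvents. -/
theorem IsSolutionMap.resolvent_eq {z : ℂ} (hz : z ∈ pmapResolventSet (L.H A B))
    (hz' : z ∈ pmapResolventSet (L.H A' B'))
    {K : EuclideanSpace ℂ (Fin 2) →ₗ[ℂ] L.maxDomain} (hK : L.IsSolutionMap A B z K)
    {G : L.Space →L[ℂ] EuclideanSpace ℂ (Fin 2)}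
    (hG : L.IsTraceResolvent (_root_.gammaAB A' B') A B z G) (f : L.Space) :
    pmapResolvent (L.H A' B') z f = pmapResolvent (L.H A B) z f -
      toSpaceCLM K (toEuclideanLin (L.bdm A B A' B' z)⁻¹ (G f)) := by
  have hne := notEigenvalue_of_mem hz
  obtain ⟨v, hv, hγ, he⟩ := exists_resolvent hz f
  obtain ⟨hm, hGf⟩ := hG f
  have hvm : v = ⟨pmapResolvent (L.H A B) z f, hm⟩ := Subtype.ext hv
  rw [← hvm] at hGf
  have hu := hK.isUnit_bdm (A' := A') (B' := B') hne (notEigenvalue_of_mem hz')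
  set c := toEuclideanLin (L.bdm A B A' B' z)⁻¹ (G f) with hc
  have hΛ : toEuclideanLin (L.bdm A B A' B' z) c = G f := by
    rw [hc, ← toEuclideanLin_mul_apply, mul_nonsing_inv _ ((isUnit_iff_isUnit_det _).1 hu)]
    simp
  -- The choice Λc = γ'v makes v − Kc satisfy the primed boundary condition without changing its
  -- image under H_max − z.
  have hγ' : _root_.gammaAB A' B' (L.bvalsMax (v - K c)) = 0 := by
    rw [map_sub, map_sub, ← hGf, ← hK.bdm_apply hne, hΛ, sub_self]
  have := resolvent_apply hz' hγ'
  rw [map_sub L.maxMap, hK.1, Submodule.coe_sub, smul_sub, sub_sub_sub_cancel_right, he] at this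
  rw [this, hv, toSpaceCLM_apply]

/-- On `ran S` the compression of a matrix mapping into `ran S` is the matrix itself. -/
lemma compression_apply {V : Submodule ℂ (EuclideanSpace ℂ (Fin 2))}
    {M : Matrix (Fin 2) (Fin 2) ℂ} (hM : ∀ y, toEuclideanLin M y ∈ V) (y : V) :
    (compression V M y : EuclideanSpace ℂ (Fin 2)) = toEuclideanLin M y := by
  have h1 : V.starProjection (y : EuclideanSpace ℂ (Fin 2)) = y :=
    Submodule.starProjection_eq_self_iff.2 y.2
  change V.starProjection (toEuclideanLin M (V.starProjection (y : EuclideanSpace ℂ (Fin 2)))) = _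
  rw [h1, Submodule.starProjection_eq_self_iff.2 (hM _)]

/-- On ran S the compression is ΛS* itself. Its kernel lies in ran S ∩ ker S* = 0, and injectivity
suffices in finite dimension. -/
theorem IsSolutionMap.isUnit_lam (h : IsBoundaryPair A B) (h' : IsBoundaryPair A' B') {w : ℂ}
    (hne : L.NotEigenvalue A B w) (hne' : L.NotEigenvalue A' B' w)
    {K : EuclideanSpace ℂ (Fin 2) →ₗ[ℂ] L.maxDomain} (hK : L.IsSolutionMap A B w K) :
    IsUnit (L.lam A B A' B' w) := by
  have hu := hK.isUnit_bdm (A' := A') (B' := B') hne hne'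
  rw [ContinuousLinearMap.isUnit_iff_bijective]
  have hinj : Function.Injective (L.lam A B A' B' w).toLinearMap := by
    rw [← LinearMap.ker_eq_bot, LinearMap.ker_eq_bot']
    intro y hy
    have h1 := compression_apply (hK.bdm_mul_mem_matRan h h' hne) y
    have h2 : compression (matRan (matS A' B' A B))
      (L.bdm A B A' B' w * (matS A' B' A B)ᴴ) y = 0 := hy
    rw [h2, Submodule.coe_zero, toEuclideanLin_mul_apply] at h1
    have h3 : toEuclideanLin (matS A' B' A B)ᴴ y = 0 := by
      have := congrArg (toEuclideanLin (L.bdm A B A' B' w)⁻¹) h1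
      rw [map_zero, ← toEuclideanLin_mul_apply,
        nonsing_inv_mul _ ((isUnit_iff_isUnit_det _).1 hu)] at this
      simpa using this.symm
    obtain ⟨x, hx⟩ := y.2
    refine Subtype.ext ?_
    rw [Submodule.coe_zero, ← inner_self_eq_zero (𝕜 := ℂ)]
    nth_rewrite 1 [← hx]
    rw [inner_toEuclideanLin_left, h3, inner_zero_right]
  exact ⟨hinj, LinearMap.injective_iff_surjective.1 hinj⟩

lemma adjoint_toEuclideanCLM_comp {E : Type*} [NormedAddCommGroup E] [InnerProductSpace ℂ E]
    [CompleteSpace E] (M : Matrix (Fin 2) (Fin 2) ℂ) (K : EuclideanSpace ℂ (Fin 2) →L[ℂ] E)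
    (c : EuclideanSpace ℂ (Fin 2)) :
    ContinuousLinearMap.adjoint (toEuclideanCLM (𝕜 := ℂ) M ∘L ContinuousLinearMap.adjoint K) c =
      K (toEuclideanLin Mᴴ c) := by
  rw [ContinuousLinearMap.adjoint_comp, ContinuousLinearMap.adjoint_adjoint,
    ContinuousLinearMap.comp_apply]
  congr 1
  refine ext_inner_left ℂ fun x => ?_
  rw [ContinuousLinearMap.adjoint_inner_right]
  exact inner_toEuclideanLin_left M x c

end SturmLiouville
end

/-! ### Assembly of the three formulas. -/

theorem theoremt4p5 (L : SturmLiouville) (A B A' B' : Matrix (Fin 2) (Fin 2) ℂ)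
    (hAB : IsBoundaryPair A B) (hAB' : IsBoundaryPair A' B') (z : ℂ)
    (hz : z ∈ pmapResolventSet (L.H A B)) (hz' : z ∈ pmapResolventSet (L.H A' B')) :
    -- the objects in the formulas are well defined
    ((L.Hmin ≤ L.H A B ∧ IsSelfAdjoint (L.H A B)) ∧
      (L.Hmin ≤ L.H A' B' ∧ IsSelfAdjoint (L.H A' B')) ∧
      starRingEnd ℂ z ∈ pmapResolventSet (L.H A B) ∧
      (∀ w ∈ ({z, starRingEnd ℂ z} : Set ℂ),
        L.IsTraceResolvent (gammaPerp A B) A B w (L.traceResolvent (gammaPerp A B) A B w) ∧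
        L.IsTraceResolvent (gammaAB A' B') A B w (L.traceResolvent (gammaAB A' B') A B w)) ∧
      L.IsBoundaryDataMap A B A' B' z (L.bdm A B A' B' z) ∧
      IsUnit (L.bdm A B A' B' z)) ∧
    -- Krein's formula
    pmapResolvent (L.H A' B') z = pmapResolvent (L.H A B) z -
      ContinuousLinearMap.adjoint (L.traceResolvent (gammaPerp A B) A B (starRingEnd ℂ z)) ∘L
        Matrix.toEuclideanCLM (𝕜 := ℂ) ((L.bdm A B A' B' z)⁻¹ * matS A' B' A B) ∘L
        L.traceResolvent (gammaPerp A B) A B z ∧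
    -- `S` invertible
    (IsUnit (matS A' B' A B) →
      IsUnit (L.bdm A B A' B' z * (matS A' B' A B)ᴴ) ∧
      pmapResolvent (L.H A' B') z = pmapResolvent (L.H A B) z -
        ContinuousLinearMap.adjoint
          (L.traceResolvent (gammaAB A' B') A B (starRingEnd ℂ z)) ∘L
          Matrix.toEuclideanCLM (𝕜 := ℂ) (L.bdm A B A' B' z * (matS A' B' A B)ᴴ)⁻¹ ∘L
          L.traceResolvent (gammaAB A' B') A B z) ∧
    -- `S` not invertible and nonzero
    (¬ IsUnit (matS A' B' A B) → matS A' B' A B ≠ 0 →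
      (∀ f, L.traceResolvent (gammaAB A' B') A B z f ∈ matRan (matS A' B' A B)) ∧
      IsUnit (L.lam A B A' B' z) ∧
      pmapResolvent (L.H A' B') z = pmapResolvent (L.H A B) z -
        ContinuousLinearMap.adjoint
          (L.traceResolvent (gammaAB A' B') A B (starRingEnd ℂ z)) ∘L
          (matRan (matS A' B' A B)).subtypeL ∘L
          Ring.inverse (L.lam A B A' B' z) ∘L
          (matRan (matS A' B' A B)).orthogonalProjectionOnto ∘L
          L.traceResolvent (gammaAB A' B') A B z) := by
  have hzc := L.conj_mem_resolventSet hAB hz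
  have hne := SturmLiouville.notEigenvalue_of_mem hz
  have hne' := SturmLiouville.notEigenvalue_of_mem hz'
  obtain ⟨K, hK⟩ : ∃ K, L.IsSolutionMap A B z K := hne.exists_solutionMap
  obtain ⟨Kc, hKc⟩ : ∃ K, L.IsSolutionMap A B (starRingEnd ℂ z) K :=
    (SturmLiouville.notEigenvalue_of_mem hzc).exists_solutionMap
  -- Conjugation swaps the points: K(z̄)* is the trace resolvent at z, and K(z)* the one at z̄.
  have perp_z := hKc.isTraceResolvent hAB (by rwa [Complex.conj_conj])
  rw [Complex.conj_conj] at perp_z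
  have perp_zc := hK.isTraceResolvent hAB hzc
  have gamma_z := perp_z.gammaAB hAB hAB' hz
  have gamma_zc := perp_zc.gammaAB hAB hAB' hzc
  have hΛ := hK.isUnit_bdm (A' := A') (B' := B') hne hne'
  have hΛdet := (Matrix.isUnit_iff_isUnit_det _).1 hΛ
  have krein := hK.resolvent_eq hz hz' gamma_z
  rw [perp_z.eq, perp_zc.eq, gamma_z.eq, gamma_zc.eq]
  refine ⟨⟨⟨L.Hmin_le_H A B, L.isSelfAdjoint_H hAB hz⟩,
    ⟨L.Hmin_le_H A' B', L.isSelfAdjoint_H hAB' hz'⟩, hzc, ?_, hK.isBoundaryDataMap hne, hΛ⟩,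
    ?_, fun hS => ?_, fun _ _ => ⟨fun f => ?_, hK.isUnit_lam hAB hAB' hne hne', ?_⟩⟩
  · rintro w (rfl | rfl)
    · exact ⟨perp_z.traceResolvent, gamma_z.traceResolvent⟩
    · exact ⟨perp_zc.traceResolvent, gamma_zc.traceResolvent⟩
  · ext1 f
    rw [krein f, ContinuousLinearMap.adjoint_adjoint]
    change _ = _ - SturmLiouville.toSpaceCLM K (Matrix.toEuclideanLin (_ * _) _)
    rw [toEuclideanLin_mul_apply]
    rfl
  · have hS' : IsUnit (matS A' B' A B)ᴴ := hS.star
    refine ⟨hΛ.mul hS', ?_⟩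
    ext1 f
    rw [krein f]
    have hlin : ∀ (M : Matrix (Fin 2) (Fin 2) ℂ) x,
        Matrix.toEuclideanCLM (𝕜 := ℂ) M x = Matrix.toEuclideanLin M x := fun _ _ => rfl
    simp only [_root_.sub_apply, ContinuousLinearMap.comp_apply]
    -- The adjoint is K(z)S*, and S*(ΛS*)⁻¹ = Λ⁻¹.
    rw [hlin (_ * _)⁻¹, SturmLiouville.adjoint_toEuclideanCLM_comp, ← toEuclideanLin_mul_apply,
      Matrix.mul_inv_rev, ← Matrix.mul_assoc,
      Matrix.mul_nonsing_inv _ ((Matrix.isUnit_iff_isUnit_det _).1 hS'), Matrix.one_mul]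
  · exact LinearMap.mem_range_self _ _
  · have hu := hK.isUnit_lam hAB hAB' hne hne'
    ext1 f
    rw [krein f]
    obtain ⟨x, hx⟩ : ∃ x : matRan (matS A' B' A B), (x : EuclideanSpace ℂ (Fin 2)) =
        (Matrix.toEuclideanCLM (𝕜 := ℂ) (matS A' B' A B) ∘L
          ContinuousLinearMap.adjoint (SturmLiouville.toSpaceCLM Kc)) f :=
      ⟨⟨_, LinearMap.mem_range_self _ _⟩, rfl⟩
    have hproj : (matRan (matS A' B' A B)).orthogonalProjectionOnto
        (x : EuclideanSpace ℂ (Fin 2)) = x :=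
      Submodule.orthogonalProjectionOnto_mem_subspace_eq_self x
    simp only [_root_.sub_apply, ContinuousLinearMap.comp_apply] at hx ⊢
    rw [← hx, hproj]
    -- With λy = x one has ΛS*y = x in ℂ², so Λ⁻¹x = S*y and KΛ⁻¹x = KS*y.
    set y := Ring.inverse (L.lam A B A' B' z) x with hy
    have h1 : L.lam A B A' B' z y = x := by
      rw [hy, ← mul_apply_eq_comp, Ring.mul_inverse_cancel _ hu]
      rfl
    have h2 := SturmLiouville.compression_apply (hK.bdm_mul_mem_matRan hAB hAB' hne) y
    have h3 := (congrArg Subtype.val h1).symm.trans h2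
    rw [h3, ← toEuclideanLin_mul_apply, ← Matrix.mul_assoc, Matrix.nonsing_inv_mul _ hΛdet,
      Matrix.one_mul, SturmLiouville.adjoint_toEuclideanCLM_comp]
    rfl
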